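/- Let $n\ge 1$, let $f:\mathbb R^n\to\mathbb R$ be differentiable with gradient $g=\nabla f$, and let $a_k,c_k$ ($k=0,1,\dots$) be real numbers. Put $$\rho=\begin{cases}\binom{n-1}{n/2}\Big/\Big(2^{n-1}+\tfrac12\binom{n}{n/2}\Big), & n\text{ even},\\[2pt] \binom{n-1}{(n-1)/2}\Big/2^{n-1}, & n\text{ odd}.\end{cases}$$ The algorithm SPSA1-A generates random vectors $\hat x_0,\hat x_1,\dots$ in $\mathbb R^n$ as follows. Let $\mathscr F_k$ be the $\sigma$-algebra generated by $\hat x_0,\dots,\hat x_k$. In iteration $k$, a perturbation $\xi_k$ is drawn uniformly from $\{-1,1\}^n$, independently of $\mathscr F_k$. With random measurement noises $\varepsilon_k^{\pm}$ one forms $$\hat g_k=\frac{\big(f(\hat x_k+c_k\xi_k)+\varepsilon_k^+\big)-\big(f(\hat x_k-c_k\xi_k)+\varepsilon_k^-\big)}{2c_k}\,\xi_k^{-1},\qquad \rho_k=\frac{\rho}{\|\hat g_k\|_\infty},$$ where $\xi_k^{-1}$ is the componentwise inverse (and $\rho_k=+\infty$, $1/(1+\rho_k)=0$ if $\hat g_k=0$).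 Given $\mathscr F_k$ and $\hat g_k$, a direction $\hat\xi_k$ is drawn uniformly from $\{d\in\{-1,1\}^n: d^T\hat g_k\ge 0\}$, and $$\hat x_{k+\frac12}=\hat x_k-\frac{a_k\,\hat g_k}{1+\rho_k},\qquad \hat x_{k+1}=\hat x_{k+\frac12}-\frac{a_k\,\hat\xi_k}{1+\rho_k}.$$ The noise satisfies $E[\varepsilon_k^+-\varepsilon_k^-\mid\mathscr F_k,\xi_k]=0$ a.s. for all $k$. Assume: 1. $a_k,c_k>0$ for all $k$, $a_k\to0$, $c_k\to 0$, $\sum_{k}a_k=\infty$ and $\sum_{k}(a_k/c_k)^2<\infty$. 2. There are $\alpha_0,\alpha_1>0$ such that $E(\varepsilon_k^\pm)^2\le\alpha_0$ and $E\big(f(\hat x_k\pm c_k\xi_k)\big)^2\le\alpha_1$ for all $k$. 3. $\sup_k\|\hat x_k\|<\infty$ a.s. 4. $x^*\in\mathbb R^n$ is an asymptotically stable solution of $d\phi/dt=-g(\phi)$: $g(x^*)=0$, $x^*$ is stable in the sense of Lyapunov, and the domain of attraction $D(x^*)$ is a neighbourhood of $x^*$. Here $D(x^*)$ is the set of initial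 values $\phi_0$ from which the equation has a solution on $[0,\infty)$ and all such solutions converge to $x^*$ as $t\to\infty$. 5. There is a compact set $S\subseteq D(x^*)$ such that, almost surely, $\hat x_k\in S$ for infinitely many $k$. 6. There are $K<\infty$ and $r>0$ such that, almost surely, for every $k\ge K$ all third order partial derivatives of $f$ exist, are continuous, and are bounded on $\{x:\|x-\hat x_k\|<r\}$. Then $\hat x_k\to x^*$ almost surely as $k\to\infty$. -/

import Mathlib

open MeasureTheory ProbabilityTheory Filter Topology
open scoped Gradient

noncomputable section

namespace SPSA

/-- Euclidean space `ℝⁿ`. -/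
abbrev E (n : ℕ) : Type := EuclideanSpace ℝ (Fin n)

/-! ### The algorithm -/

/-- The set `{-1, 1}ⁿ` of sign vectors. -/
def signCube (n : ℕ) : Set (E n) := {d | ∀ i, d i = 1 ∨ d i = -1}

/-- The sign vectors `d` with `dᵀ g ≥ 0`. -/
def halfCube {n : ℕ} (g : E n) : Set (E n) := {d | d ∈ signCube n ∧ 0 ≤ inner ℝ d g}

/-- The componentwise inverse of a vector. -/
def cwInv {n : ℕ} (v : E n) : E n := WithLp.toLp 2 (fun i => (v i)⁻¹)

/-- The maximum norm of a vector (the norm of `Fin n → ℝ` is the maximum norm). -/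
def supNorm {n : ℕ} (v : E n) : ℝ := ‖WithLp.ofLp v‖

/-- The constant `ρ` of the algorithm in dimension `n ≥ 1`. -/
def rhoConst (n : ℕ) : ℝ :=
  if Even n then
    (Nat.choose (n - 1) (n / 2) : ℝ) / (2 ^ (n - 1) + (Nat.choose n (n / 2) : ℝ) / 2)
  else
    (Nat.choose (n - 1) ((n - 1) / 2) : ℝ) / 2 ^ (n - 1)

/-- The simultaneous perturbation gradient estimate built from the two noisy measurements
`f (x + c ξ) + εp` and `f (x - c ξ) + εm`. -/
def gradEst {n : ℕ} (f : E n → ℝ) (c : ℝ) (x ξ : E n) (εp εm : ℝ) : E n :=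
  (((f (x + c • ξ) + εp) - (f (x - c • ξ) + εm)) / (2 * c)) • cwInv ξ

/-- The factor `1 / (1 + ρ_k)` with `ρ_k = ρ / ‖g‖_∞`. For `g = 0` one has `ρ_k = +∞`, so that
the factor is `0`. -/
def damping {n : ℕ} (g : E n) : ℝ :=
  open Classical in if g = 0 then 0 else 1 / (1 + rhoConst n / supNorm g)

/-- The first half of an iteration, from `x_k` to `x_{k + 1/2}`. -/
def halfStep {n : ℕ} (a : ℝ) (x g : E n) : E n := x - (a * damping g) • g

/-- A full iteration, from `x_k` to `x_{k + 1}`, with gradient estimate `g` and second search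
direction `d`. -/
def fullStep {n : ℕ} (a : ℝ) (x g d : E n) : E n := halfStep a x g - (a * damping g) • d

variable {Ω : Type*}

/-- The gradient estimates `ĝ_k` along a run. -/
def gHat {n : ℕ} (f : E n → ℝ) (c : ℕ → ℝ) (x ξ : ℕ → Ω → E n) (εp εm : ℕ → Ω → ℝ)
    (k : ℕ) (ω : Ω) : E n :=
  gradEst f (c k) (x k ω) (ξ k ω) (εp k ω) (εm k ω)

/-- The σ-algebra `F_k` generated by `x_0, …, x_k`. -/
abbrev history {n : ℕ} (x : ℕ → Ω → E n) (k : ℕ) : MeasurableSpace Ω :=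
  ⨆ i : ℕ, ⨆ _ : i ≤ k, MeasurableSpace.comap (x i) inferInstance

/-- `x` is the sequence of iterates of the algorithm SPSA1-A for the objective `f`, the gains `a`,
`c`, the perturbations `ξ`, the measurement noises `εp`, `εm` and the second search directions
`ξhat`, on the probability space `(Ω, P)`. -/
structure IsRun [MeasurableSpace Ω] {n : ℕ} (P : Measure Ω) (f : E n → ℝ) (a c : ℕ → ℝ)
    (x ξ ξhat : ℕ → Ω → E n) (εp εm : ℕ → Ω → ℝ) : Prop where
  measurable_init : Measurable (x 0)
  measurable_pert : ∀ k, Measurable (ξ k)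
  measurable_dir : ∀ k, Measurable (ξhat k)
  measurable_noise_plus : ∀ k, Measurable (εp k)
  measurable_noise_minus : ∀ k, Measurable (εm k)
  /-- `ξ_k` is uniformly distributed on `{-1, 1}ⁿ`. -/
  pert_law : ∀ k, P.map (ξ k) = uniformOn (signCube n)
  /-- `ξ_k` is independent of `x_0, …, x_k`. -/
  pert_indep : ∀ k, Indep (MeasurableSpace.comap (ξ k) inferInstance) (history x k) P
  /-- Given `x_0, …, x_k` and `ĝ_k`, the direction `ξ̂_k` is uniformly distributed on the sign
  vectors `d` with `dᵀ ĝ_k ≥ 0`. -/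
  dir_law : ∀ k, ∀ B : Set (E n), MeasurableSet B →
    P⟦ξhat k ⁻¹' B |
        history x k ⊔ MeasurableSpace.comap (gHat f c x ξ εp εm k) inferInstance⟧
      =ᵐ[P] fun ω => (uniformOn (halfCube (gHat f c x ξ εp εm k ω))).real B
  step : ∀ k, ∀ ω, x (k + 1) ω = fullStep (a k) (x k ω) (gHat f c x ξ εp εm k ω) (ξhat k ω)

/-! ### The differential equation `dφ/dt = -∇f(φ)` -/

/-- `φ` solves `dφ/dt = -∇f(φ)` on the time set `s` (one-sided derivatives at end points). -/
def IsSol {n : ℕ} (f : E n → ℝ) (φ : ℝ → E n) (s : Set ℝ) : Prop :=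
  IsIntegralCurveOn φ (fun _ y => -(∇ f y)) s

/-- The domain of attraction of `xs`: the initial values `φ₀` from which the equation has a
solution for all times `t ≥ 0`, every such solution converging to `xs`. -/
def domainOfAttraction {n : ℕ} (f : E n → ℝ) (xs : E n) : Set (E n) :=
  {φ₀ | (∃ φ : ℝ → E n, φ 0 = φ₀ ∧ IsSol f φ (Set.Ici 0)) ∧
    ∀ φ : ℝ → E n, φ 0 = φ₀ → IsSol f φ (Set.Ici 0) → Tendsto φ atTop (𝓝 xs)}

/-- Stability in the sense of Lyapunov. Solutions on all intervals `[0, T]` are considered, so that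
also solutions that explode in finite time have to stay close to `xs`. -/
def IsLyapunovStable {n : ℕ} (f : E n → ℝ) (xs : E n) : Prop :=
  ∀ ε > 0, ∃ δ > 0, ∀ T : ℝ, 0 ≤ T → ∀ φ : ℝ → E n, IsSol f φ (Set.Icc 0 T) →
    dist (φ 0) xs < δ → ∀ t ∈ Set.Icc 0 T, dist (φ t) xs < ε

/-- `xs` is an asymptotically stable (constant) solution of `dφ/dt = -∇f(φ)`: an equilibrium that
is Lyapunov stable and whose domain of attraction is a neighbourhood of it. -/
def IsAsymptoticallyStable {n : ℕ} (f : E n → ℝ) (xs : E n) : Prop :=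
  ∇ f xs = 0 ∧ IsLyapunovStable f xs ∧ domainOfAttraction f xs ∈ 𝓝 xs

/-! ### The smoothness condition -/

/-- On the open ball of radius `r` about `y`, all third order partial derivatives of `f` exist, are
continuous, and are bounded. -/
def ThirdDerivGoodNear {n : ℕ} (f : E n → ℝ) (y : E n) (r : ℝ) : Prop :=
  ContDiffOn ℝ 3 f (Metric.ball y r) ∧
  ∃ M : ℝ, ∀ z ∈ Metric.ball y r, ∀ i j l : Fin n,
    |iteratedFDeriv ℝ 3 f z
      ![EuclideanSpace.single i 1, EuclideanSpace.single j 1, EuclideanSpace.single l 1]| ≤ M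

end SPSA

end

/-! The damping is tuned so that the second half step costs nothing in the mean. Each estimate `ĝ_k`
is a scalar times a sign vector, say `t • s` with `t = ‖ĝ_k‖_∞ > 0`. By symmetry, a uniform sign
vector `d` with `⟨d, s⟩ ≥ 0` has mean `ρ • s`. So `ĝ_k + ξ̂_k` has conditional mean `(t + ρ) • s =
(1 + ρ_k) • ĝ_k`, and the factor `1 / (1 + ρ_k)` leaves exactly `ĝ_k` (`damping_mul_add_mean`).
Averaging over the noise and over `ξ_k` gives the step the conditional mean `-a_k • meanGradEst f
c_k x_k` (`condExp_step`). This mean estimate tends to `∇ f y` as `c_k → 0` and `x_k → y`, because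
uniform sign vectors have identity covariance (`tendsto_meanGradEst`).

The deviations from the conditional mean are martingale differences with second moments of order
`(a_k / c_k)²`, which is summable. Their partial sums therefore converge almost surely
(`ae_exists_tendsto_error`).

What remains concerns a single trajectory: an Euler scheme for `φ' = -∇ f φ` with vanishing step
sizes and convergent accumulated error. On the time scale `a_0 + ⋯ + a_{k-1}`, its late pieces
converge along ultrafilters to solutions of the equation
(`IsPerturbedEuler.exists_isIntegralCurveOn`). Visits to `S` yield limit curves that are attracted
to `x*`, so the iterates come arbitrarily close to `x*` again and again. Infinitely many excursions
away from `x*` would produce a limit curve that contradicts stability or attraction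
(`IsPerturbedEuler.tendsto`). -/

noncomputable section

namespace SPSA

/-! ### Perturbed Euler schemes and their limiting differential equation -/

section LimitODE

variable {F : Type*} [NormedAddCommGroup F] [NormedSpace ℝ F]

/-- The elapsed time `a 0 + ⋯ + a (k - 1)` before step `k`. -/
def elapsed (a : ℕ → ℝ) (k : ℕ) : ℝ := ∑ i ∈ Finset.range k, a i

lemma elapsed_succ (a : ℕ → ℝ) (k : ℕ) : elapsed a (k + 1) = elapsed a k + a k :=
  Finset.sum_range_succ a k

lemma elapsed_monotone {a : ℕ → ℝ} (ha : ∀ k, 0 ≤ a k) : Monotone (elapsed a) :=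
  monotone_nat_of_le_succ fun k => by rw [elapsed_succ]; linarith [ha k]

/-- A perturbed Euler scheme `x (k + 1) - x k = a k • u k + (e (k + 1) - e k)`. -/
def IsPerturbedEuler (a : ℕ → ℝ) (x u e : ℕ → F) : Prop :=
  ∀ k, x (k + 1) = x k + a k • u k + (e (k + 1) - e k)

variable {a : ℕ → ℝ} {x u e : ℕ → F}

lemma IsPerturbedEuler.norm_sub_le_of_le (h : IsPerturbedEuler a x u e) (ha : ∀ k, 0 ≤ a k)
    {k l : ℕ} (hkl : k ≤ l) (w : F) {η : ℝ} (hη : ∀ i, k ≤ i → i < l → ‖u i - w‖ ≤ η) :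
    ‖x l - x k - (elapsed a l - elapsed a k) • w - (e l - e k)‖
      ≤ η * (elapsed a l - elapsed a k) := by
  induction l, hkl using Nat.le_induction with
  | base => simp
  | succ l hkl ih =>
    have h1 := ih fun i hi hil => hη i hi (by omega)
    have h2 := hη l hkl (by omega)
    have h3 : x (l + 1) - x k - (elapsed a (l + 1) - elapsed a k) • w - (e (l + 1) - e k)
        = (x l - x k - (elapsed a l - elapsed a k) • w - (e l - e k)) + a l • (u l - w) := by
      rw [h l, elapsed_succ]; module
    have h4 : ‖a l • (u l - w)‖ ≤ a l * η := by
      rw [norm_smul, Real.norm_of_nonneg (ha l)]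
      exact mul_le_mul_of_nonneg_left h2 (ha l)
    rw [h3, elapsed_succ]
    refine (norm_add_le _ _).trans ?_
    linarith

/-- The order of `k` and `l` is left open because differentiating a limit curve at time `s` involves
both earlier and later times. -/
lemma IsPerturbedEuler.norm_sub_le (h : IsPerturbedEuler a x u e) (ha : ∀ k, 0 ≤ a k)
    (k l : ℕ) (w : F) {η : ℝ} (hη : ∀ i, min k l ≤ i → i < max k l → ‖u i - w‖ ≤ η) :
    ‖x l - x k - (elapsed a l - elapsed a k) • w‖
      ≤ η * |elapsed a l - elapsed a k| + ‖e l - e k‖ := by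
  rcases le_total k l with hkl | hkl
  · have h1 := h.norm_sub_le_of_le ha hkl w (η := η) (by simpa [hkl] using hη)
    rw [abs_of_nonneg (sub_nonneg.2 (elapsed_monotone ha hkl))]
    have := norm_add_le (x l - x k - (elapsed a l - elapsed a k) • w - (e l - e k)) (e l - e k)
    rw [sub_add_cancel] at this
    linarith
  · have h1 := h.norm_sub_le_of_le ha hkl w (η := η) (by simpa [hkl] using hη)
    rw [abs_of_nonpos (sub_nonpos.2 (elapsed_monotone ha hkl)), norm_sub_rev (e l)]
    have h2 := norm_add_le (x k - x l - (elapsed a k - elapsed a l) • w - (e k - e l)) (e k - e l)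
    rw [sub_add_cancel] at h2
    have h3 : x l - x k - (elapsed a l - elapsed a k) • w
        = -(x k - x l - (elapsed a k - elapsed a l) • w) := by module
    rw [h3, norm_neg]
    linarith

lemma exists_elapsed_ge (ha_sum : Tendsto (elapsed a) atTop atTop) (m : ℕ) (s : ℝ) :
    ∃ l, m ≤ l ∧ elapsed a m + s ≤ elapsed a l :=
  ((eventually_ge_atTop m).and (ha_sum.eventually_ge_atTop _)).exists

/-- Indices reached a time `s` after index `m`. -/
lemma exists_index_after (ha : ∀ k, 0 ≤ a k) (ha_lim : Tendsto a atTop (𝓝 0))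
    (ha_sum : Tendsto (elapsed a) atTop atTop) {s : ℝ} (hs : 0 ≤ s) :
    ∃ p : ℕ → ℕ, (∀ m, m ≤ p m) ∧ (∀ m, elapsed a m + s ≤ elapsed a (p m)) ∧
      (∀ m l, m ≤ l → elapsed a m + s ≤ elapsed a l → p m ≤ l) ∧
      Tendsto (fun m => elapsed a (p m) - elapsed a m) atTop (𝓝 s) := by
  classical
  have hex := exists_elapsed_ge ha_sum
  refine ⟨fun m => Nat.find (hex m s), fun m => (Nat.find_spec (hex m s)).1,
    fun m => (Nat.find_spec (hex m s)).2, fun m l h1 h2 => Nat.find_min' _ ⟨h1, h2⟩, ?_⟩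
  rw [Metric.tendsto_atTop]
  intro ε hε
  obtain ⟨M, hM⟩ := (Metric.tendsto_atTop.1 ha_lim) ε hε
  refine ⟨M, fun m hm => ?_⟩
  beta_reduce
  obtain ⟨h1, h2⟩ := Nat.find_spec (hex m s)
  have h3 := fun l (hl : l < Nat.find (hex m s)) => Nat.find_min (hex m s) hl
  generalize Nat.find (hex m s) = p at h1 h2 h3
  rw [Real.dist_eq, abs_of_nonneg (by linarith)]
  -- The index just before `p` has not yet reached time `s`, so the overshoot is less than one step
  -- size, and late step sizes are below `ε`.
  rcases h1.eq_or_lt with rfl | hlt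
  · linarith
  · obtain ⟨q, rfl⟩ : ∃ q, p = q + 1 := ⟨p - 1, by omega⟩
    have h4 := h3 q (by omega)
    have h5 : elapsed a q < elapsed a m + s := by
      by_contra hcon
      exact h4 ⟨by omega, by linarith⟩
    have h6 := hM q (by omega)
    rw [Real.dist_eq, sub_zero, abs_of_nonneg (ha q)] at h6
    rw [elapsed_succ]
    linarith

omit [NormedSpace ℝ F] in
/-- The drift `u` of a scheme with iterates in a compact set is eventually bounded, if it is close
to `v y` whenever the iterate is close to `y`. -/
lemma eventually_norm_le_of_isCompact {v : F → F} {A : Set F} (hA : IsCompact A)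
    (hxA : ∀ k, x k ∈ A)
    (hu : ∀ y, Tendsto u (atTop ⊓ comap x (𝓝 y)) (𝓝 (v y))) :
    ∃ M, 0 ≤ M ∧ ∀ᶠ k in atTop, ‖u k‖ ≤ M := by
  suffices h : ∃ M, 0 ≤ M ∧ ∀ᶠ k in atTop, x k ∈ A → ‖u k‖ ≤ M by
    obtain ⟨M, h0, hM⟩ := h
    exact ⟨M, h0, hM.mono fun k hk => hk (hxA k)⟩
  refine hA.induction_on (p := fun s => ∃ M, 0 ≤ M ∧ ∀ᶠ k in atTop, x k ∈ s → ‖u k‖ ≤ M)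
    ⟨0, le_rfl, by simp⟩ ?_ ?_ ?_
  · rintro s t hst ⟨M, h0, hM⟩
    exact ⟨M, h0, hM.mono fun k hk hs => hk (hst hs)⟩
  · rintro s t ⟨M, h0, hM⟩ ⟨M', h0', hM'⟩
    refine ⟨max M M', le_max_of_le_left h0, ?_⟩
    filter_upwards [hM, hM'] with k h1 h2
    rintro (h | h)
    exacts [(h1 h).trans (le_max_left _ _), (h2 h).trans (le_max_right _ _)]
  · intro y _
    have h1 : ∀ᶠ k in atTop ⊓ comap x (𝓝 y), ‖u k‖ ≤ ‖v y‖ + 1 :=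
      ((hu y).norm.eventually_lt_const (lt_add_one _)).mono fun _ => le_of_lt
    obtain ⟨s, hs, t, ht, hst⟩ := mem_inf_iff_superset.1 h1
    obtain ⟨w, hw, hwt⟩ := ht
    refine ⟨w, mem_nhdsWithin_of_mem_nhds hw, ‖v y‖ + 1, by positivity, ?_⟩
    filter_upwards [hs] with k hk hkw using hst ⟨hk, hwt hkw⟩

/-- Ultrafilter limits of a perturbed Euler scheme solve the differential equation. -/
theorem IsPerturbedEuler.exists_isIntegralCurveOn (h : IsPerturbedEuler a x u e)
    (ha : ∀ k, 0 ≤ a k) (ha_lim : Tendsto a atTop (𝓝 0))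
    (ha_sum : Tendsto (elapsed a) atTop atTop) {e' : F} (he : Tendsto e atTop (𝓝 e'))
    {A : Set F} (hA : IsCompact A) (hxA : ∀ k, x k ∈ A) {v : F → F}
    (hu : ∀ y, Tendsto u (atTop ⊓ comap x (𝓝 y)) (𝓝 (v y)))
    (l : Ultrafilter ℕ) (hl : (l : Filter ℕ) ≤ atTop) :
    ∃ φ : ℝ → F, IsIntegralCurveOn φ (fun _ => v) (Set.Ici 0) ∧
      ∀ s, 0 ≤ s → ∀ p : ℕ → ℕ, (∀ m, m ≤ p m) →
        Tendsto (fun m => elapsed a (p m) - elapsed a m) l (𝓝 s) →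
        Tendsto (fun m => x (p m)) l (𝓝 (φ s)) := by
  obtain ⟨M, hM0, hM⟩ := eventually_norm_le_of_isCompact hA hxA hu
  have hid : Tendsto (fun m : ℕ => m) l atTop := hl
  have hatTop : ∀ p : ℕ → ℕ, (∀ m, m ≤ p m) → Tendsto p l atTop := fun p hp =>
    tendsto_atTop_mono hp hid
  have hlim : ∀ p : ℕ → ℕ, ∃ y, Tendsto (fun m => x (p m)) l (𝓝 y) := fun p => by
    obtain ⟨y, -, hy⟩ := hA.ultrafilter_le_nhds (l.map fun m => x (p m))
      (le_principal_iff.2 ((univ_mem' fun m => hxA (p m) : (fun m => x (p m)) ⁻¹' A ∈ (l : Filter ℕ))))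
    exact ⟨y, hy⟩
  have hdiffE : ∀ p q : ℕ → ℕ, (∀ m, m ≤ p m) → (∀ m, m ≤ q m) →
      Tendsto (fun m => ‖e (q m) - e (p m)‖) l (𝓝 0) := fun p q hp hq => by
    simpa using ((he.comp (hatTop q hq)).sub (he.comp (hatTop p hp))).norm
  have hlip : ∀ p q : ℕ → ℕ, (∀ m, m ≤ p m) → (∀ m, m ≤ q m) →
      ∀ᶠ m in l, ‖x (q m) - x (p m)‖
        ≤ M * |elapsed a (q m) - elapsed a (p m)| + ‖e (q m) - e (p m)‖ := by
    intro p q hp hq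
    obtain ⟨N, hN⟩ := eventually_atTop.1 hM
    filter_upwards [hid.eventually_ge_atTop N] with m hm
    have := h.norm_sub_le ha (p m) (q m) 0 (η := M) (fun i hi _ => by
      rw [sub_zero]
      exact hN i (hm.trans ((le_min (hp m) (hq m)).trans hi)))
    simpa using this
  -- The drift is bounded and the increments of `e` vanish, so two index choices with the same
  -- limiting elapsed time have the same limit of iterates. This makes the limit curve well defined.
  have huniq : ∀ p q : ℕ → ℕ, (∀ m, m ≤ p m) → (∀ m, m ≤ q m) → ∀ s y z,
      Tendsto (fun m => elapsed a (p m) - elapsed a m) l (𝓝 s) →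
      Tendsto (fun m => elapsed a (q m) - elapsed a m) l (𝓝 s) →
      Tendsto (fun m => x (p m)) l (𝓝 y) → Tendsto (fun m => x (q m)) l (𝓝 z) → z = y := by
    intro p q hp hq s y z hps hqs hy hz
    have h1 : Tendsto (fun m => M * |elapsed a (q m) - elapsed a (p m)| + ‖e (q m) - e (p m)‖) l
        (𝓝 0) := by
      simpa using ((hqs.sub hps).abs.const_mul M).add (hdiffE p q hp hq)
    have h2 := le_of_tendsto_of_tendsto (hz.sub hy).norm h1 (hlip p q hp hq)
    exact sub_eq_zero.1 (norm_le_zero_iff.1 h2)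
  have hφ : ∀ s : ℝ, ∃ y, 0 ≤ s → ∃ p : ℕ → ℕ, (∀ m, m ≤ p m) ∧
      Tendsto (fun m => elapsed a (p m) - elapsed a m) l (𝓝 s) ∧
      Tendsto (fun m => x (p m)) l (𝓝 y) := by
    intro s
    by_cases hs : 0 ≤ s
    · obtain ⟨p, hp, -, -, hps⟩ := exists_index_after ha ha_lim ha_sum hs
      obtain ⟨y, hy⟩ := hlim p
      exact ⟨y, fun _ => ⟨p, hp, hps.mono_left hl, hy⟩⟩
    -- Arbitrary value at negative times, where the curve is never examined.
    · exact ⟨0, fun hs' => absurd hs' hs⟩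
  choose φ hφ using hφ
  refine ⟨φ, fun s hs => ?_, fun s hs p hp hps => ?_⟩
  · rw [hasDerivWithinAt_iff_isLittleO, Asymptotics.isLittleO_iff]
    intro ε hε
    obtain ⟨p, hp, hps, hpx⟩ := hφ s hs
    have h1 : ∀ᶠ k in atTop ⊓ comap x (𝓝 (φ s)), ‖u k - v (φ s)‖ ≤ ε := by
      have := (hu (φ s)).eventually (Metric.closedBall_mem_nhds _ hε)
      simpa [dist_eq_norm] using this
    obtain ⟨t, ht, w, ⟨w', hw', hww⟩, htw⟩ := mem_inf_iff_superset.1 h1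
    obtain ⟨N, hN⟩ := mem_atTop_sets.1 ht
    obtain ⟨δ, hδ, hball⟩ := Metric.mem_nhds_iff.1 hw'
    -- All iterates between the indices for `s` and `s'` must stay within `δ` of `φ s`, where the
    -- drift is `ε`-close to `v (φ s)`. The budget is `δ / 4` for the drift, `δ / 4` for the
    -- increment of `e`, and `δ / 2` for the distance of `x (p m)` from `φ s`.
    have hev : ∀ᶠ s' in 𝓝[Set.Ici 0] s, 0 ≤ s' ∧ M * |s' - s| < δ / 4 := by
      refine Filter.Eventually.and self_mem_nhdsWithin (mem_nhdsWithin_of_mem_nhds ?_)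
      have : Tendsto (fun s' => M * |s' - s|) (𝓝 s) (𝓝 (M * |s - s|)) := by
        apply Continuous.tendsto; fun_prop
      rw [sub_self, abs_zero, mul_zero] at this
      exact this.eventually_lt_const (by positivity)
    filter_upwards [hev] with s' ⟨hs', hclose⟩
    obtain ⟨q, hq, hqs, hqx⟩ := hφ s' hs'
    have htend : Tendsto (fun m => M * |elapsed a (q m) - elapsed a (p m)|) l
        (𝓝 (M * |s' - s|)) := by
      simpa using ((hqs.sub hps).abs.const_mul M)
    have heC : ∃ N', ∀ i ≥ N', ∀ j ≥ N', dist (e i) (e j) < δ / 4 :=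
      Metric.cauchySeq_iff.1 he.cauchySeq _ (by positivity)
    obtain ⟨N', hN'⟩ := heC
    obtain ⟨N'', hN''⟩ := eventually_atTop.1 hM
    have hmain : ∀ᶠ m in l, ‖x (q m) - x (p m) - (elapsed a (q m) - elapsed a (p m)) • v (φ s)‖
        ≤ ε * |elapsed a (q m) - elapsed a (p m)| + ‖e (q m) - e (p m)‖ := by
      filter_upwards [hid.eventually_ge_atTop N, hid.eventually_ge_atTop N',
        hid.eventually_ge_atTop N'', htend.eventually_lt_const hclose,
        hpx.eventually (Metric.ball_mem_nhds _ (half_pos hδ))] with m hm hm' hm'' hmt hmx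
      refine h.norm_sub_le ha (p m) (q m) _ fun i hi hi' => ?_
      have hmi : m ≤ i := (le_min (hp m) (hq m)).trans hi
      refine htw ⟨hN i (hm.trans hmi), hww (hball ?_)⟩
      have h2 := h.norm_sub_le ha (p m) i 0 (η := M) (fun j hj _ => by
        rw [sub_zero]
        exact hN'' j (hm''.trans ((le_min (hp m) hmi).trans hj)))
      rw [smul_zero, sub_zero] at h2
      have h3 : |elapsed a i - elapsed a (p m)| ≤ |elapsed a (q m) - elapsed a (p m)| := by
        have hmono := elapsed_monotone ha
        rcases le_total (p m) (q m) with hpq | hpq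
        · rw [min_eq_left hpq] at hi
          rw [max_eq_right hpq] at hi'
          rw [abs_of_nonneg (sub_nonneg.2 (hmono hi)), abs_of_nonneg (sub_nonneg.2 (hmono hpq))]
          linarith [hmono hi'.le]
        · rw [min_eq_right hpq] at hi
          rw [max_eq_left hpq] at hi'
          rw [abs_of_nonpos (sub_nonpos.2 (hmono hi'.le)),
            abs_of_nonpos (sub_nonpos.2 (hmono hpq))]
          linarith [hmono hi]
      have h4 := hN' i (hm'.trans hmi) (p m) (hm'.trans (hp m))
      rw [dist_eq_norm] at h4
      have h5 := mul_le_mul_of_nonneg_left h3 hM0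
      rw [Metric.mem_ball]
      have h6 := dist_triangle (x i) (x (p m)) (φ s)
      rw [dist_eq_norm (x i) (x (p m))] at h6
      linarith
    have hL : Tendsto (fun m => ‖x (q m) - x (p m)
        - (elapsed a (q m) - elapsed a (p m)) • v (φ s)‖) l
        (𝓝 ‖φ s' - φ s - (s' - s) • v (φ s)‖) := by
      refine ((hqx.sub hpx).sub (Tendsto.smul_const ?_ _)).norm
      simpa using hqs.sub hps
    have hR : Tendsto (fun m => ε * |elapsed a (q m) - elapsed a (p m)| + ‖e (q m) - e (p m)‖) l
        (𝓝 (ε * |s' - s|)) := by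
      simpa using ((hqs.sub hps).abs.const_mul ε).add (hdiffE p q hp hq)
    exact le_of_tendsto_of_tendsto hL hR hmain
  · obtain ⟨q, hq, hqs, hqx⟩ := hφ s hs
    obtain ⟨y, hy⟩ := hlim p
    rwa [huniq p q hp hq s y (φ s) hps hqs hy hqx]

/-- The theorem of Kushner and Clark for perturbed Euler schemes. -/
theorem IsPerturbedEuler.tendsto (h : IsPerturbedEuler a x u e)
    (ha : ∀ k, 0 ≤ a k) (ha_lim : Tendsto a atTop (𝓝 0))
    (ha_sum : Tendsto (elapsed a) atTop atTop) {e' : F} (he : Tendsto e atTop (𝓝 e'))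
    {A : Set F} (hA : IsCompact A) (hxA : ∀ k, x k ∈ A) {v : F → F}
    (hu : ∀ y, Tendsto u (atTop ⊓ comap x (𝓝 y)) (𝓝 (v y)))
    {xs : F} {D : Set F} (hDxs : D ∈ 𝓝 xs)
    (hD : ∀ φ : ℝ → F, φ 0 ∈ D → IsIntegralCurveOn φ (fun _ => v) (Set.Ici 0) →
      Tendsto φ atTop (𝓝 xs))
    (hstable : ∀ ε > 0, ∃ δ > 0, ∀ T : ℝ, 0 ≤ T → ∀ φ : ℝ → F,
      IsIntegralCurveOn φ (fun _ => v) (Set.Icc 0 T) →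
      dist (φ 0) xs < δ → ∀ t ∈ Set.Icc 0 T, dist (φ t) xs < ε)
    {S : Set F} (hS : IsCompact S) (hSD : S ⊆ D) (hvisit : ∃ᶠ k in atTop, x k ∈ S) :
    Tendsto x atTop (𝓝 xs) := by
  have key := h.exists_isIntegralCurveOn ha ha_lim ha_sum he hA hxA hu
  have hzero : ∀ l : Ultrafilter ℕ, Tendsto (fun m : ℕ => elapsed a m - elapsed a m) l (𝓝 0) :=
    fun l => by simp
  -- A limit curve taken along the visits to `S` starts in the closed set `S ⊆ D`, hence comes close
  -- to `xs`; the iterates that approximate it do so as well.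
  have hclus : ∀ ε > 0, ∃ᶠ k in atTop, dist (x k) xs < ε := by
    intro ε hε
    have : NeBot (atTop ⊓ 𝓟 {k | x k ∈ S}) := frequently_mem_iff_neBot.1 hvisit
    set l : Ultrafilter ℕ := Ultrafilter.of (atTop ⊓ 𝓟 {k | x k ∈ S})
    have hl : (l : Filter ℕ) ≤ atTop ⊓ 𝓟 {k | x k ∈ S} := Ultrafilter.of_le _
    obtain ⟨φ, hφ, hlim⟩ := key l (hl.trans inf_le_left)
    have h0 : Tendsto x l (𝓝 (φ 0)) := hlim 0 le_rfl id (fun m => le_rfl) (hzero l)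
    have hxS : ∀ᶠ m in l, x m ∈ S := (hl.trans inf_le_right) (mem_principal_self _)
    have h1 : φ 0 ∈ D := hSD (hS.isClosed.mem_of_tendsto h0 hxS)
    have h2 := hD φ h1 hφ
    obtain ⟨s, hs, hs0⟩ := ((h2.eventually (Metric.ball_mem_nhds _ hε)).and
      (eventually_ge_atTop 0)).exists
    obtain ⟨p, hp, -, -, hps⟩ := exists_index_after ha ha_lim ha_sum hs0
    have h3 := hlim s hs0 p hp (hps.mono_left (hl.trans inf_le_left))
    have h4 : ∀ᶠ m in l, dist (x (p m)) xs < ε := h3.eventually (Metric.isOpen_ball.mem_nhds hs)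
    have h5 : Tendsto p l atTop := tendsto_atTop_mono hp (hl.trans inf_le_left)
    exact h5.frequently h4.frequently
  by_contra hcon
  rw [Metric.tendsto_nhds] at hcon
  push Not at hcon
  obtain ⟨ε, hε, hfar⟩ := hcon
  obtain ⟨δ, hδ, hstab⟩ := hstable ε hε
  obtain ⟨r, hr, hrD⟩ := Metric.mem_nhds_iff.1 hDxs
  obtain ⟨δ₁, hδ₁, hδ₁'⟩ : ∃ δ₁, 0 < δ₁ ∧ δ₁ < min (min δ r) ε :=
    exists_between (by positivity)
  simp only [lt_min_iff] at hδ₁'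
  obtain ⟨⟨hδ₁δ, hδ₁r⟩, hδ₁ε⟩ := hδ₁'
  -- Starting indices of excursions: the last index in the `δ₁`-ball before distance `ε` is reached.
  -- As `δ₁ < δ` and `δ₁ < r`, a limit curve along `B` starts where both stability and attraction
  -- apply.
  set B : Set ℕ := {m | dist (x m) xs < δ₁ ∧
      ∃ p, m ≤ p ∧ ε ≤ dist (x p) xs ∧ ∀ i, m < i → i ≤ p → δ₁ ≤ dist (x i) xs} with hB
  have hexc : ∃ᶠ m in atTop, m ∈ B := by
    rw [frequently_atTop]
    intro N
    obtain ⟨m₀, hm₀N, hm₀⟩ := frequently_atTop.1 (hclus δ₁ hδ₁) N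
    obtain ⟨p, hp, hpε⟩ := frequently_atTop.1 hfar m₀
    classical
    have hP : dist (x m₀) xs < δ₁ := hm₀
    set m := Nat.findGreatest (fun i => dist (x i) xs < δ₁) p with hm
    refine ⟨m, hm₀N.trans (Nat.le_findGreatest hp hP),
      Nat.findGreatest_spec (P := fun i => dist (x i) xs < δ₁) hp hP, p,
      Nat.findGreatest_le p, by simpa using hpε, fun i hi hip => ?_⟩
    exact not_lt.1 (Nat.findGreatest_is_greatest hi hip)
  have := frequently_mem_iff_neBot.1 hexc
  set l : Ultrafilter ℕ := Ultrafilter.of (atTop ⊓ 𝓟 B)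
  have hl : (l : Filter ℕ) ≤ _ := Ultrafilter.of_le (atTop ⊓ 𝓟 B)
  have hl1 : (l : Filter ℕ) ≤ atTop := hl.trans inf_le_left
  have hl2 := (hl.trans inf_le_right) (mem_principal_self _)
  obtain ⟨φ, hφ, hlim⟩ := key l hl1
  have h0 : Tendsto x l (𝓝 (φ 0)) := hlim 0 le_rfl id (fun m => le_rfl) (hzero l)
  have hφ0 : dist (φ 0) xs ≤ δ₁ :=
    le_of_tendsto (h0.dist tendsto_const_nhds) (mem_of_superset hl2 fun m hm => hm.1.le)
  have hp : ∀ m, ∃ p, m ≤ p ∧ (m ∈ B →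
      ε ≤ dist (x p) xs ∧ ∀ i, m < i → i ≤ p → δ₁ ≤ dist (x i) xs) := by
    intro m
    by_cases hm : m ∈ B
    · obtain ⟨-, p, h1, h2⟩ := hm
      exact ⟨p, h1, fun _ => h2⟩
    · exact ⟨m, le_rfl, fun h => absurd h hm⟩
  choose p hmp hp using hp
  have hpε : ∀ᶠ m in l, ε ≤ dist (x (p m)) xs := mem_of_superset hl2 fun m hm => (hp m hm).1
  -- If the durations of the excursions are bounded along `l`, they converge to some `τ` with `dist
  -- (φ τ) xs ≥ ε`, against stability. Otherwise they eventually exceed every bound along the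
  -- ultrafilter, so `φ` stays outside the open `δ₁`-ball at all positive times, against attraction.
  by_cases hT : ∃ T, ∀ᶠ m in l, elapsed a (p m) - elapsed a m ≤ T
  · obtain ⟨T, hT⟩ := hT
    have hnn : ∀ m, 0 ≤ elapsed a (p m) - elapsed a m := fun m =>
      sub_nonneg.2 (elapsed_monotone ha (hmp m))
    obtain ⟨τ, hτ, hτl⟩ := (isCompact_Icc (a := (0 : ℝ)) (b := T)).ultrafilter_le_nhds
      (l.map fun m => elapsed a (p m) - elapsed a m)
      (by
        rw [le_principal_iff]
        exact mem_of_superset (x := {m | elapsed a (p m) - elapsed a m ≤ T}) (f := (l : Filter ℕ)) hT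
          fun m hm => ⟨hnn m, hm⟩)
    have h1 := hlim τ hτ.1 p hmp hτl
    have h2 : ε ≤ dist (φ τ) xs := ge_of_tendsto (h1.dist tendsto_const_nhds) hpε
    have h3 := hstab τ hτ.1 φ (hφ.mono Set.Icc_subset_Ici_self) (hφ0.trans_lt hδ₁δ) τ
      ⟨hτ.1, le_rfl⟩
    linarith
  · push Not at hT
    have h1 := hD φ (hrD (Metric.mem_ball.2 (hφ0.trans_lt hδ₁r))) hφ
    obtain ⟨s, hs, hs0⟩ := ((h1.eventually (Metric.ball_mem_nhds _ hδ₁)).and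
      (eventually_gt_atTop 0)).exists
    obtain ⟨q, hq, hq1, hq2, hqs⟩ := exists_index_after ha ha_lim ha_sum hs0.le
    have h3 := hlim s hs0.le q hq (hqs.mono_left hl1)
    have h4 := hT s
    have h5 : δ₁ ≤ dist (φ s) xs := by
      refine ge_of_tendsto (h3.dist tendsto_const_nhds) ?_
      filter_upwards [h4, hl2] with m hm hm2
      -- The index `q m` lies inside the excursion: strictly after `m` since `s > 0`, and not after
      -- `p m` since the excursion lasts longer than `s`.
      refine (hp m hm2).2 (q m) (lt_of_le_of_ne (hq m) fun hcon => ?_)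
        (hq2 m _ (hmp m) (by linarith))
      have := hq1 m
      rw [← hcon] at this
      linarith
    exact hs.not_ge h5

end LimitODE

/-! ### Sign vectors and their covariance -/

/-- The sign vector that is `1` on `A` and `-1` off `A`. -/
def signVec {n : ℕ} (A : Finset (Fin n)) : E n := WithLp.toLp 2 fun i => if i ∈ A then 1 else -1

lemma signVec_apply {n : ℕ} (A : Finset (Fin n)) (i : Fin n) :
    signVec A i = if i ∈ A then 1 else -1 := rfl

lemma signVec_mem_signCube {n : ℕ} (A : Finset (Fin n)) : signVec A ∈ signCube n := fun i => by
  rw [signVec_apply]; split_ifs <;> simp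

lemma signVec_injective {n : ℕ} : Function.Injective (signVec (n := n)) := fun A B h => by
  ext i
  have := congrFun (congrArg WithLp.ofLp h) i
  by_contra hcon
  simp only [signVec_apply] at this
  split_ifs at this <;> first | tauto | norm_num at this

lemma signCube_eq_range (n : ℕ) : signCube n = Set.range (signVec (n := n)) := by
  ext d
  refine ⟨fun hd => ⟨Finset.univ.filter fun i => d i = 1, ?_⟩, ?_⟩
  · ext i
    rw [signVec_apply]
    rcases hd i with h | h <;> simp [h]
    norm_num
  · rintro ⟨A, rfl⟩
    exact signVec_mem_signCube A

/-- Switching the sign in coordinate `i`. -/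
def flipEquiv {n : ℕ} (i : Fin n) : Finset (Fin n) ≃ Finset (Fin n) :=
  (symmDiff_right_involutive ({i} : Finset (Fin n))).toPerm

lemma signVec_flip_self {n : ℕ} (i : Fin n) (A : Finset (Fin n)) :
    signVec (flipEquiv i A) i = -signVec A i := by
  have : i ∈ flipEquiv i A ↔ i ∉ A := by
    change i ∈ symmDiff {i} A ↔ _
    simp [Finset.mem_symmDiff]
  simp only [signVec_apply, this]
  split_ifs <;> simp_all

lemma signVec_flip_of_ne {n : ℕ} {i j : Fin n} (hij : j ≠ i) (A : Finset (Fin n)) :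
    signVec (flipEquiv i A) j = signVec A j := by
  have : j ∈ flipEquiv i A ↔ j ∈ A := by
    change j ∈ symmDiff {i} A ↔ _
    simp [Finset.mem_symmDiff, hij]
  simp only [signVec_apply, this]

/-- For `j ≠ i`, flipping the sign of coordinate `i` permutes the cube and negates the sum. -/
lemma sum_signVec_mul {n : ℕ} (i j : Fin n) :
    ∑ A : Finset (Fin n), signVec A j * signVec A i = if j = i then (2 : ℝ) ^ n else 0 := by
  split_ifs with h
  · subst h
    have : ∀ A : Finset (Fin n), signVec A j * signVec A j = 1 := fun A => by
      rcases signVec_mem_signCube A j with h | h <;> simp [h]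
    simp [this]
  · have h1 := Equiv.sum_comp (flipEquiv i) fun A => signVec A j * signVec A i
    simp only [signVec_flip_self, signVec_flip_of_ne h, mul_neg, Finset.sum_neg_distrib] at h1
    linarith

/-- Identity covariance: directional derivatives, weighted by their directions and averaged over the
cube, give back the gradient. -/
lemma sum_inner_smul_signVec {n : ℕ} (w : E n) :
    ((2 : ℝ) ^ n)⁻¹ • ∑ A : Finset (Fin n), inner ℝ w (signVec A) • signVec A = w := by
  ext i
  have h1 : ∀ A : Finset (Fin n), inner ℝ w (signVec A) * signVec A i
      = ∑ j, w j * (signVec A j * signVec A i) := fun A => by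
    rw [PiLp.inner_apply, Finset.sum_mul]
    refine Finset.sum_congr rfl fun j _ => ?_
    simp only [RCLike.inner_apply, conj_trivial]
    ring
  have h2 : (∑ A : Finset (Fin n), inner ℝ w (signVec A) • signVec A) i
      = ∑ A : Finset (Fin n), inner ℝ w (signVec A) * signVec A i := by
    simp
  rw [PiLp.smul_apply, h2, Finset.sum_congr rfl fun A _ => h1 A, Finset.sum_comm]
  simp only [← Finset.mul_sum, sum_signVec_mul, smul_eq_mul, mul_ite, mul_zero,
    Finset.sum_ite_eq', Finset.mem_univ, if_true]
  field_simp

/-! ### Central differences and convergence of a single trajectory -/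

/-- The central difference quotient of `f` at `x` in direction `s` with step `c`. -/
def diffQuot {n : ℕ} (f : E n → ℝ) (c : ℝ) (x s : E n) : ℝ :=
  (f (x + c • s) - f (x - c • s)) / (2 * c)

/-- The mean of the noise free gradient estimates. -/
def meanGradEst {n : ℕ} (f : E n → ℝ) (c : ℝ) (x : E n) : E n :=
  ((2 : ℝ) ^ n)⁻¹ • ∑ A : Finset (Fin n), diffQuot f c x (signVec A) • signVec A

/-- The base point moves while the step shrinks, so differentiability at `y` alone would not do.
Being `C¹` at `y` gives strict differentiability, applied to the two endpoints, which differ by `2 c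
s`. -/
lemma tendsto_diffQuot {n : ℕ} {f : E n → ℝ} {y : E n} (hf : ContDiffAt ℝ 1 f y) {ι : Type*}
    {l : Filter ι} {c : ι → ℝ} {x : ι → E n} (hc_pos : ∀ k, 0 < c k) (hc : Tendsto c l (𝓝 0))
    (hx : Tendsto x l (𝓝 y)) (s : E n) :
    Tendsto (fun k => diffQuot f (c k) (x k) s) l (𝓝 (inner ℝ (∇ f y) s)) := by
  have h1 := (hf.hasStrictFDerivAt (by norm_num)).isLittleO
  have hu : Tendsto (fun k => x k + c k • s) l (𝓝 y) := by
    simpa using hx.add (hc.smul_const s)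
  have hv : Tendsto (fun k => x k - c k • s) l (𝓝 y) := by
    simpa using hx.sub (hc.smul_const s)
  have h2 := h1.comp_tendsto (hu.prodMk_nhds hv)
  have h3 : (fun k => (x k + c k • s) - (x k - c k • s)) =O[l] fun k => 2 * c k := by
    refine Asymptotics.IsBigO.of_bound ‖s‖ (Eventually.of_forall fun k => ?_)
    rw [show (x k + c k • s) - (x k - c k • s) = (2 * c k) • s by module, norm_smul, mul_comm]
  have h4 := (h2.trans_isBigO h3).tendsto_div_nhds_zero
  rw [inner_gradient_left]
  have h5 := h4.add_const (fderiv ℝ f y s)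
  rw [zero_add] at h5
  refine h5.congr fun k => ?_
  have hck := (hc_pos k).ne'
  simp only [Function.comp, diffQuot]
  rw [show (x k + c k • s) - (x k - c k • s) = (2 * c k) • s by module, map_smul, smul_eq_mul]
  field_simp
  ring

lemma tendsto_meanGradEst {n : ℕ} {f : E n → ℝ} {y : E n} (hf : ContDiffAt ℝ 1 f y) {ι : Type*}
    {l : Filter ι} {c : ι → ℝ} {x : ι → E n} (hc_pos : ∀ k, 0 < c k) (hc : Tendsto c l (𝓝 0))
    (hx : Tendsto x l (𝓝 y)) :
    Tendsto (fun k => meanGradEst f (c k) (x k)) l (𝓝 (∇ f y)) := by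
  rw [← sum_inner_smul_signVec (∇ f y)]
  exact (tendsto_finsetSum _ fun A _ =>
    (tendsto_diffQuot hf hc_pos hc hx (signVec A)).smul_const _).const_smul _

/-- Convergence of a single trajectory whose accumulated error converges. -/
theorem tendsto_of_summable_error {n : ℕ} {f : E n → ℝ} {xs : E n} {a c : ℕ → ℝ} {x : ℕ → E n}
    {K : ℕ} {r : ℝ} (hr : 0 < r) (hsmooth : ∀ k, K ≤ k → ThirdDerivGoodNear f (x k) r)
    (ha_pos : ∀ k, 0 < a k) (hc_pos : ∀ k, 0 < c k)
    (ha_lim : Tendsto a atTop (𝓝 0)) (hc_lim : Tendsto c atTop (𝓝 0))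
    (ha_sum : Tendsto (fun N => ∑ k ∈ Finset.range N, a k) atTop atTop)
    {R : ℝ} (hbdd : ∀ k, ‖x k‖ ≤ R) (hstable : IsAsymptoticallyStable f xs)
    {S : Set (E n)} (hS : IsCompact S) (hSD : S ⊆ domainOfAttraction f xs)
    (hvisit : ∃ᶠ k in atTop, x k ∈ S) {e' : E n}
    (herr : Tendsto (fun N => ∑ k ∈ Finset.range N,
      (x (k + 1) - x k + a k • meanGradEst f (c k) (x k))) atTop (𝓝 e')) :
    Tendsto x atTop (𝓝 xs) := by
  have heuler : IsPerturbedEuler a x (fun k => -meanGradEst f (c k) (x k)) (fun N =>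
      ∑ k ∈ Finset.range N, (x (k + 1) - x k + a k • meanGradEst f (c k) (x k))) := fun k => by
    simp only [Finset.sum_range_succ]; module
  refine heuler.tendsto (fun k => (ha_pos k).le) ha_lim ha_sum herr
    (isCompact_closedBall (0 : E n) R) (fun k => by simpa using hbdd k) (v := fun y => -(∇ f y))
    (fun y => ?_) hstable.2.2 (fun φ h0 hφ => h0.2 φ rfl hφ) hstable.2.1 hS hSD hvisit
  -- Only cluster points `y` matter. Some late iterate is within `r` of such a `y`, so `y` lies in a
  -- ball on which `f` is smooth.
  rcases (atTop ⊓ comap x (𝓝 y)).eq_or_neBot with hbot | hne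
  · rw [hbot]; exact tendsto_bot
  · have hx : Tendsto x (atTop ⊓ comap x (𝓝 y)) (𝓝 y) := tendsto_comap.mono_left inf_le_right
    obtain ⟨k, hk, hkK⟩ := ((hx.eventually (Metric.ball_mem_nhds y hr)).and
      ((eventually_ge_atTop K).filter_mono inf_le_left)).exists
    have hy : y ∈ Metric.ball (x k) r := Metric.mem_ball_comm.1 hk
    have hf : ContDiffAt ℝ 1 f y :=
      ((hsmooth k hkK).1.contDiffAt (Metric.isOpen_ball.mem_nhds hy)).of_le (by norm_num)
    exact (tendsto_meanGradEst hf hc_pos (hc_lim.mono_left inf_le_left) hx).neg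

/-! ### The mean of the second search direction -/

/-- The index sets of the sign vectors with nonnegative coordinate sum. -/
def majority (n : ℕ) : Finset (Finset (Fin n)) := Finset.univ.filter fun A => n ≤ 2 * A.card

lemma sum_signVec {n : ℕ} (A : Finset (Fin n)) : ∑ i, signVec A i = 2 * (A.card : ℝ) - n := by
  have h1 : ∀ i, signVec A i = 2 * (if i ∈ A then 1 else 0) - 1 := fun i => by
    rw [signVec_apply]; split_ifs <;> norm_num
  simp [h1, Finset.sum_sub_distrib, mul_comm]

/-- Pair each `B` not containing `i` with `insert i B`. The contributions `-1` and `1` cancel unless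
only the larger set is a majority, which means `2 |B| < n ≤ 2 |B| + 2`, that is, `|B| = (n + 1) / 2
- 1`. -/
lemma sum_majority_signVec {n : ℕ} (i : Fin n) :
    ∑ A ∈ majority n, signVec A i = (Nat.choose (n - 1) ((n + 1) / 2 - 1) : ℝ) := by
  have hn := i.pos
  have hcard : (Finset.univ.erase i).card = n - 1 := by simp
  have huniv : (Finset.univ : Finset (Finset (Fin n)))
      = (insert i (Finset.univ.erase i)).powerset := by
    rw [Finset.insert_erase (Finset.mem_univ i), Finset.powerset_univ]
  rw [majority, Finset.sum_filter, huniv, Finset.sum_powerset_insert (Finset.notMem_erase i _),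
    ← Finset.sum_add_distrib, ← hcard, ← Finset.card_powersetCard, Finset.card_eq_sum_ones,
    Nat.cast_sum, Finset.powersetCard_eq_filter, Finset.sum_filter]
  refine Finset.sum_congr rfl fun B hB => ?_
  have hi : i ∉ B := fun h => Finset.notMem_erase i _ (Finset.mem_powerset.1 hB h)
  rw [Finset.card_insert_of_notMem hi, signVec_apply, signVec_apply, if_neg hi,
    if_pos (Finset.mem_insert_self i B)]
  split_ifs <;> first | omega | norm_num

/-- Complementation exchanges majorities and minorities. Together these cover all sets, and they
overlap in the ties, which occur only for even `n`. -/
lemma card_majority (n : ℕ) :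
    2 * (majority n).card = 2 ^ n + (if Even n then Nat.choose n (n / 2) else 0) := by
  have h1 : (majority n).card
      = (Finset.univ.filter fun A : Finset (Fin n) => 2 * A.card ≤ n).card := by
    refine Finset.card_bij' (fun A _ => Aᶜ) (fun A _ => Aᶜ) ?_ ?_ (by simp) (by simp)
    all_goals
      intro A hA
      simp only [majority, Finset.mem_filter, Finset.mem_univ, true_and, Finset.card_compl,
        Fintype.card_fin] at hA ⊢
      omega
  have h2 : (Finset.univ.filter fun A : Finset (Fin n) => 2 * A.card = n).card
      = if Even n then Nat.choose n (n / 2) else 0 := by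
    split_ifs with h
    · have : (Finset.univ.filter fun A : Finset (Fin n) => 2 * A.card = n)
          = Finset.powersetCard (n / 2) Finset.univ := by
        ext A
        have := Nat.even_iff.1 h
        simp only [Finset.mem_filter, Finset.mem_univ, true_and, Finset.mem_powersetCard,
          Finset.subset_univ]
        omega
      rw [this, Finset.card_powersetCard, Finset.card_univ, Fintype.card_fin]
    · rw [Finset.card_eq_zero, Finset.filter_eq_empty_iff]
      intro A _ hA
      exact h ⟨A.card, by omega⟩
  have h3 := Finset.card_union_add_card_inter (majority n)
    (Finset.univ.filter fun A : Finset (Fin n) => 2 * A.card ≤ n)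
  have h4 : majority n ∪ (Finset.univ.filter fun A : Finset (Fin n) => 2 * A.card ≤ n)
      = Finset.univ := by
    ext A
    simp only [majority, Finset.mem_union, Finset.mem_filter, Finset.mem_univ, true_and, iff_true]
    omega
  have h5 : majority n ∩ (Finset.univ.filter fun A : Finset (Fin n) => 2 * A.card ≤ n)
      = Finset.univ.filter fun A : Finset (Fin n) => 2 * A.card = n := by
    ext A
    simp only [majority, Finset.mem_inter, Finset.mem_filter, Finset.mem_univ, true_and]
    omega
  rw [h4, h5, h2, ← h1, Finset.card_univ, Fintype.card_finset, Fintype.card_fin] at h3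
  omega

lemma card_majority_pos (n : ℕ) : 0 < (majority n).card := by
  have := card_majority n
  have := pow_pos (show 0 < 2 by norm_num) n
  omega

/-- The origin of `ρ`: it is the mean of each coordinate over the sign vectors with nonnegative sum.
For even `n`, symmetry of the binomial coefficient matches the two forms of the numerator. -/
lemma sum_majority_signVec_eq_rhoConst {n : ℕ} (i : Fin n) :
    ∑ A ∈ majority n, signVec A i = rhoConst n * (majority n).card := by
  have hn := i.pos
  have h2 : 2 * ((majority n).card : ℝ) = 2 ^ n + (if Even n then Nat.choose n (n / 2) else 0 : ℕ) :=
    by exact_mod_cast card_majority n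
  have hpow : (2 : ℝ) ^ n = 2 * 2 ^ (n - 1) := by
    rw [← pow_succ', Nat.sub_add_cancel hn]
  rw [sum_majority_signVec, rhoConst]
  split_ifs at h2 ⊢ with h
  · have h3 : ((majority n).card : ℝ) = 2 ^ (n - 1) + (Nat.choose n (n / 2) : ℝ) / 2 := by linarith
    rw [← h3, div_mul_cancel₀ _ (by exact_mod_cast (card_majority_pos n).ne')]
    congr 1
    have := Nat.even_iff.1 h
    rw [← Nat.choose_symm (show n / 2 ≤ n - 1 by omega)]
    congr 1
    omega
  · have h3 : ((majority n).card : ℝ) = 2 ^ (n - 1) := by push_cast at h2; linarith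
    rw [h3, div_mul_cancel₀ _ (by positivity)]
    congr 2
    have := Nat.not_even_iff.1 h
    omega

/-- Index sets of sign vectors, transformed by coordinatewise multiplication with `signVec B`. -/
def signMulEquiv {n : ℕ} (B : Finset (Fin n)) : Finset (Fin n) ≃ Finset (Fin n) where
  toFun A := (symmDiff A B)ᶜ
  invFun A := (symmDiff A B)ᶜ
  left_inv A := by ext i; simp
  right_inv A := by ext i; simp

lemma signVec_signMulEquiv {n : ℕ} (A B : Finset (Fin n)) (i : Fin n) :
    signVec (signMulEquiv B A) i = signVec A i * signVec B i := by
  have : i ∈ signMulEquiv B A ↔ (i ∈ A ↔ i ∈ B) := by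
    change i ∈ (symmDiff A B)ᶜ ↔ _
    simp
  simp only [signVec_apply, this]
  by_cases h1 : i ∈ A <;> by_cases h2 : i ∈ B <;> simp [h1, h2]

/-- Coordinatewise multiplication by `signVec B` turns the inner product with `signVec B` into the
coordinate sum, so every half cube reduces to the majority case. -/
lemma signVec_mem_halfCube_iff {n : ℕ} (A B : Finset (Fin n)) {t : ℝ} (ht : 0 < t) :
    signVec A ∈ halfCube (t • signVec B) ↔ signMulEquiv B A ∈ majority n := by
  have h1 : inner ℝ (signVec A) (signVec B) = ∑ i, signVec (signMulEquiv B A) i := by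
    rw [PiLp.inner_apply]
    refine Finset.sum_congr rfl fun i _ => ?_
    rw [signVec_signMulEquiv]
    simp [mul_comm]
  simp only [halfCube, Set.mem_ofPred_eq, signVec_mem_signCube, true_and, inner_smul_right, h1,
    sum_signVec, majority, Finset.mem_filter, Finset.mem_univ]
  rw [mul_nonneg_iff_of_pos_left ht, sub_nonneg]
  exact_mod_cast Iff.rfl

lemma halfCube_eq_coe_map {n : ℕ} (B : Finset (Fin n)) {t : ℝ} (ht : 0 < t) :
    halfCube (t • signVec B)
      = (((majority n).map (signMulEquiv B).symm.toEmbedding).map ⟨signVec, signVec_injective⟩ :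
        Finset (E n)) := by
  ext d
  simp only [Finset.coe_map, Set.mem_image, Finset.mem_coe]
  constructor
  · intro hd
    obtain ⟨A, rfl⟩ := (signCube_eq_range n).subset hd.1
    exact ⟨A, ⟨_, (signVec_mem_halfCube_iff A B ht).1 hd, by simp⟩, rfl⟩
  · rintro ⟨A, ⟨C, hC, rfl⟩, rfl⟩
    exact (signVec_mem_halfCube_iff _ B ht).2 (by simpa using hC)

lemma uniformOn_real_singleton {α : Type*} [DecidableEq α] [MeasurableSpace α]
    [MeasurableSingletonClass α] (s : Finset α) (d : α) :
    (uniformOn (s : Set α)).real {d} = if d ∈ s then (s.card : ℝ)⁻¹ else 0 := by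
  rw [measureReal_def, ← Finset.coe_singleton, uniformOn_apply_finset]
  split_ifs with h
  · simp [Finset.inter_singleton_of_mem h]
  · simp [Finset.inter_singleton_of_notMem h]

lemma uniformOn_halfCube_real {n : ℕ} (A B : Finset (Fin n)) {t : ℝ} (ht : 0 < t) :
    (uniformOn (halfCube (t • signVec B))).real {signVec A}
      = if signMulEquiv B A ∈ majority n then ((majority n).card : ℝ)⁻¹ else 0 := by
  classical
  rw [halfCube_eq_coe_map B ht, uniformOn_real_singleton, Finset.card_map, Finset.card_map]
  refine if_congr ?_ rfl rfl
  rw [← signVec_mem_halfCube_iff A B ht, halfCube_eq_coe_map B ht, Finset.mem_coe]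

/-- The mean of a uniformly distributed element of `halfCube g` is `ρ g / ‖g‖_∞`, if `g` is a
positive multiple of a sign vector. -/
lemma sum_uniformOn_halfCube {n : ℕ} (B : Finset (Fin n)) {t : ℝ} (ht : 0 < t) (i : Fin n) :
    ∑ A : Finset (Fin n), signVec A i * (uniformOn (halfCube (t • signVec B))).real {signVec A}
      = rhoConst n * signVec B i := by
  have h0 : ((majority n).card : ℝ) ≠ 0 := by exact_mod_cast (card_majority_pos n).ne'
  have h1 : ∀ A, signVec A i * (uniformOn (halfCube (t • signVec B))).real {signVec A}
      = signVec B i * ((majority n).card : ℝ)⁻¹ * (if signMulEquiv B A ∈ majority n then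
        signVec (signMulEquiv B A) i else 0) := fun A => by
    rw [uniformOn_halfCube_real A B ht, signVec_signMulEquiv]
    split_ifs
    · have : signVec B i * signVec B i = 1 := by
        rcases signVec_mem_signCube B i with h | h <;> simp [h]
      linear_combination (-signVec A i * ((majority n).card : ℝ)⁻¹) * this
    · simp
  rw [Finset.sum_congr rfl fun A _ => h1 A, ← Finset.mul_sum,
    Equiv.sum_comp (signMulEquiv B) fun C => if C ∈ majority n then signVec C i else 0,
    Finset.sum_ite_mem, Finset.univ_inter, sum_majority_signVec_eq_rhoConst]
  field_simp

lemma supNorm_smul_signVec {n : ℕ} (B : Finset (Fin n)) (i : Fin n) {t : ℝ} (ht : 0 ≤ t) :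
    supNorm (t • signVec B) = t := by
  have : Nonempty (Fin n) := ⟨i⟩
  have h1 : ∀ j, ‖(t • signVec B) j‖ = t := fun j => by
    rw [PiLp.smul_apply, norm_smul, Real.norm_of_nonneg ht]
    rcases signVec_mem_signCube B j with h | h <;> simp [h]
  refine le_antisymm ((pi_norm_le_iff_of_nonneg ht).2 fun j => (h1 j).le) ?_
  have := norm_le_pi_norm (WithLp.ofLp (t • signVec B)) i
  rwa [h1 i] at this

lemma rhoConst_nonneg (n : ℕ) : 0 ≤ rhoConst n := by
  unfold rhoConst; split_ifs <;> positivity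

/-- A negative scalar passes its sign to the vector, so every gradient estimate is a nonnegative
multiple of a sign vector. -/
lemma exists_eq_smul_signVec {n : ℕ} {v : E n} (hv : v ∈ signCube n) (σ : ℝ) :
    ∃ B : Finset (Fin n), σ • v = |σ| • signVec B := by
  rcases le_total 0 σ with h | h
  · obtain ⟨B, rfl⟩ := (signCube_eq_range n).subset hv
    exact ⟨B, by rw [abs_of_nonneg h]⟩
  · have hv' : -v ∈ signCube n := fun i => by
      rcases hv i with h | h <;> simp [h]
    obtain ⟨B, hB⟩ := (signCube_eq_range n).subset hv'
    exact ⟨B, by rw [abs_of_nonpos h, hB]; simp⟩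

/-- The two search directions of an iteration add up to the gradient estimate in the mean. -/
lemma damping_mul_add_mean {n : ℕ} {v : E n} (hv : v ∈ signCube n) (σ : ℝ) (i : Fin n) :
    damping (σ • v) * ((σ • v) i + ∑ A : Finset (Fin n),
      signVec A i * (uniformOn (halfCube (σ • v))).real {signVec A}) = (σ • v) i := by
  obtain ⟨B, hB⟩ := exists_eq_smul_signVec hv σ
  rw [hB]
  rcases (abs_nonneg σ).eq_or_lt with h | h
  -- For a zero estimate, the convention `damping 0 = 0` makes both sides vanish.
  · simp [← h, damping]
  · have hne : |σ| • signVec B ≠ 0 := fun hcon => by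
      have := supNorm_smul_signVec B i h.le
      rw [hcon] at this
      have h0 : supNorm (0 : E n) = 0 := norm_zero
      linarith
    rw [sum_uniformOn_halfCube B h, damping, if_neg hne, supNorm_smul_signVec B i h.le]
    have := rhoConst_nonneg n
    have h2 : |σ| + rhoConst n ≠ 0 := by positivity
    -- With `t = |σ|`, the damping is `t / (t + ρ)` and the bracket is `(t + ρ)` times the sign.
    rw [PiLp.smul_apply, smul_eq_mul]
    field_simp

lemma damping_nonneg {n : ℕ} (g : E n) : 0 ≤ damping g := by
  unfold damping
  split_ifs
  · exact le_rfl
  · have := rhoConst_nonneg n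
    have : 0 ≤ supNorm g := norm_nonneg _
    positivity

lemma damping_le_one {n : ℕ} (g : E n) : damping g ≤ 1 := by
  unfold damping
  split_ifs
  · exact zero_le_one
  · have := rhoConst_nonneg n
    have : 0 ≤ supNorm g := norm_nonneg _
    have h : 0 ≤ rhoConst n / supNorm g := by positivity
    rw [div_le_one (by positivity)]
    linarith

lemma measurable_damping {n : ℕ} : Measurable (damping (n := n)) := by
  have h : Measurable (supNorm (n := n)) :=
    (continuous_norm.comp (PiLp.continuous_ofLp 2 _)).measurable
  exact Measurable.ite (measurableSet_singleton (0 : E n)) measurable_const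
    (measurable_const.div (measurable_const.add (measurable_const.div h)))

lemma finite_signCube (n : ℕ) : (signCube n).Finite := by
  rw [signCube_eq_range]; exact Set.finite_range _

lemma uniformOn_signCube_real {n : ℕ} (A : Finset (Fin n)) :
    (uniformOn (signCube n)).real {signVec A} = ((2 : ℝ) ^ n)⁻¹ := by
  classical
  have : signCube n = ((Finset.univ.map ⟨signVec, signVec_injective⟩ : Finset (E n)) : Set (E n)) := by
    rw [signCube_eq_range]; simp
  rw [this, uniformOn_real_singleton, Finset.card_map, Finset.card_univ, Fintype.card_finset,
    Fintype.card_fin, if_pos (by simp)]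
  norm_num

/-! ### Convergence of square integrable martingales -/

section Martingale

variable {Ω : Type*} {m0 : MeasurableSpace Ω} {P : Measure Ω} [IsProbabilityMeasure P]

/-- The conditional expectation minimizes the mean square error up to the total second moment. -/
lemma integral_sub_condExp_sq_le {m : MeasurableSpace Ω} (hm : m ≤ m0) {Y : Ω → ℝ}
    (hY : MemLp Y 2 P) : ∫ ω, (Y ω - (P[Y | m]) ω) ^ 2 ∂P ≤ ∫ ω, Y ω ^ 2 ∂P := by
  have h1 := integral_condVar_add_variance_condExp hm hY
  have h2 : ∫ ω, (condVar m Y P) ω ∂P = ∫ ω, (Y ω - (P[Y | m]) ω) ^ 2 ∂P :=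
    integral_condExp hm
  have h3 := variance_le_expectation_sq hY.aestronglyMeasurable
  have h4 := variance_nonneg (P[Y | m]) P
  rw [← h2]
  simp only [Pi.pow_apply] at h3
  linarith

/-- A martingale in `L²` with summable second moments of the increments converges. -/
theorem ae_exists_tendsto_sum_of_condExp_eq_zero (ℱ : Filtration ℕ m0) {d : ℕ → Ω → ℝ}
    (hd_meas : ∀ k, StronglyMeasurable[ℱ (k + 1)] (d k)) (hd : ∀ k, MemLp (d k) 2 P)
    (hd_zero : ∀ k, P[d k | ℱ k] =ᵐ[P] 0) {b : ℕ → ℝ} (hb : Summable b)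
    (hdb : ∀ k, ∫ ω, d k ω ^ 2 ∂P ≤ b k) :
    ∀ᵐ ω ∂P, ∃ l, Tendsto (fun N => ∑ k ∈ Finset.range N, d k ω) atTop (𝓝 l) := by
  set M : ℕ → Ω → ℝ := fun N => ∑ k ∈ Finset.range N, d k with hM
  have hM_succ : ∀ N, M (N + 1) = M N + d N := fun N => Finset.sum_range_succ _ _
  have hadp : StronglyAdapted ℱ M := fun N =>
    Finset.stronglyMeasurable_sum _ fun k hk =>
      (hd_meas k).mono (ℱ.mono (Finset.mem_range.1 hk))
  have hLp : ∀ N, MemLp (M N) 2 P := fun N => memLp_finsetSum' _ fun k _ => hd k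
  have hint : ∀ N, Integrable (M N) P := fun N => (hLp N).integrable one_le_two
  have hmart : Martingale M ℱ P := martingale_of_condExp_sub_eq_zero_nat hadp hint fun N => by
    rw [hM_succ, add_sub_cancel_left]
    exact hd_zero N
  have horth : ∀ N, ∫ ω, M N ω * d N ω ∂P = 0 := fun N => by
    have h1 : P[M N * d N | ℱ N] =ᵐ[P] M N * P[d N | ℱ N] :=
      condExp_mul_of_stronglyMeasurable_left (hadp N) ((hLp N).integrable_mul (hd N))
        ((hd N).integrable one_le_two)
    have h2 : ∫ ω, (M N * d N) ω ∂P = ∫ ω, (P[M N * d N | ℱ N]) ω ∂P :=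
      (integral_condExp (ℱ.le N)).symm
    have h3 : P[M N * d N | ℱ N] =ᵐ[P] 0 := by
      filter_upwards [h1, hd_zero N] with ω hω h0
      simp [hω, h0]
    rw [integral_congr_ae h3] at h2
    simpa using h2
  have hsq : ∀ N, ∫ ω, M N ω ^ 2 ∂P ≤ ∑ k ∈ Finset.range N, b k := by
    intro N
    induction N with
    | zero => simp [hM]
    | succ N ih =>
      have h1 : ∫ ω, M (N + 1) ω ^ 2 ∂P
          = ∫ ω, M N ω ^ 2 ∂P + 2 * ∫ ω, M N ω * d N ω ∂P + ∫ ω, d N ω ^ 2 ∂P := by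
        have h2 : Integrable (fun ω => 2 * (M N ω * d N ω)) P :=
          ((hLp N).integrable_mul (hd N)).const_mul 2
        have h3 : Integrable (fun ω => M N ω ^ 2 + 2 * (M N ω * d N ω)) P :=
          (hLp N).integrable_sq.add h2
        rw [← integral_const_mul, ← integral_add (hLp N).integrable_sq h2,
          ← integral_add h3 (hd N).integrable_sq]
        refine integral_congr_ae (Eventually.of_forall fun ω => ?_)
        simp only [hM_succ, Pi.add_apply]
        ring
      rw [h1, horth, Finset.sum_range_succ]
      linarith [hdb N]
  have hb0 : ∀ k, 0 ≤ b k := fun k => (integral_nonneg fun ω => sq_nonneg _).trans (hdb k)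
  -- The convergence theorem needs an `L¹` bound, which follows from the second moments through `|M|
  -- ≤ 1 + M²`.
  have hbound : ∀ N, eLpNorm (M N) 1 P ≤ ((1 + ∑' k, b k).toNNReal : NNReal) := by
    intro N
    rw [eLpNorm_one_eq_lintegral_enorm, ← ofReal_integral_norm_eq_lintegral_enorm (hint N)]
    refine ENNReal.ofReal_le_ofReal ?_
    have h1 : ∫ ω, ‖M N ω‖ ∂P ≤ ∫ ω, (1 + M N ω ^ 2) ∂P := by
      refine integral_mono (hint N).norm ((integrable_const 1).add (hLp N).integrable_sq) fun ω => ?_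
      simp only [Real.norm_eq_abs]
      nlinarith [sq_abs (M N ω), sq_nonneg (|M N ω| - 1), abs_nonneg (M N ω)]
    rw [integral_add (integrable_const 1) (hLp N).integrable_sq] at h1
    simp only [integral_const, probReal_univ, smul_eq_mul, mul_one] at h1
    linarith [hsq N, hb.sum_le_tsum (Finset.range N) fun k _ => hb0 k]
  filter_upwards [hmart.submartingale.exists_ae_tendsto_of_bdd hbound] with ω hω
  obtain ⟨l, hl⟩ := hω
  exact ⟨l, by simpa [hM, Finset.sum_apply] using hl⟩

end Martingale

/-! ### Measurability and laws along a run -/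

section Run

variable {Ω : Type*} [MeasurableSpace Ω] {n : ℕ}

lemma measurable_cwInv : Measurable (cwInv (n := n)) :=
  (PiLp.continuous_toLp 2 _).measurable.comp <| measurable_pi_lambda _ fun i =>
    ((EuclideanSpace.proj (𝕜 := ℝ) i).continuous.measurable).inv

lemma measurable_coord (i : Fin n) : Measurable fun v : E n => v i :=
  (EuclideanSpace.proj (𝕜 := ℝ) i).continuous.measurable

lemma cwInv_mem_signCube {v : E n} (hv : v ∈ signCube n) : cwInv v ∈ signCube n := fun i => by
  change (v i)⁻¹ = 1 ∨ (v i)⁻¹ = -1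
  rcases hv i with h | h <;> simp [h]

/-- One of `d` and `-d` always qualifies. Nonemptiness makes the uniform law on the half cube a
probability measure. -/
lemma halfCube_nonempty (g : E n) : (halfCube g).Nonempty := by
  rcases le_total 0 (inner ℝ (signVec ∅) g) with h | h
  · exact ⟨_, signVec_mem_signCube _, h⟩
  · refine ⟨-signVec ∅, fun i => ?_, ?_⟩
    · rcases signVec_mem_signCube (n := n) ∅ i with h | h <;> simp [h]
    · rw [inner_neg_left]; linarith

lemma uniformOn_halfCube_signCube (g : E n) : (uniformOn (halfCube g)).real (signCube n) = 1 := by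
  rw [measureReal_def, uniformOn_eq_one_of ((finite_signCube n).subset fun d hd => hd.1)
    (halfCube_nonempty g) fun d hd => hd.1, ENNReal.toReal_one]

variable {P : Measure Ω} {f : E n → ℝ} {a c : ℕ → ℝ}
  {x ξ ξhat : ℕ → Ω → E n} {εp εm : ℕ → Ω → ℝ}

namespace IsRun

lemma measurable_gHat_of (hrun : IsRun P f a c x ξ ξhat εp εm) (hf : Continuous f) {k : ℕ}
    (hx : Measurable (x k)) : Measurable (gHat f c x ξ εp εm k) := by
  have h1 := hrun.measurable_pert k
  have h2 := hrun.measurable_noise_plus k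
  have h3 := hrun.measurable_noise_minus k
  have h4 : Measurable fun ω => f (x k ω + c k • ξ k ω) :=
    hf.measurable.comp (hx.add (h1.const_smul (c k)))
  have h5 : Measurable fun ω => f (x k ω - c k • ξ k ω) :=
    hf.measurable.comp (hx.sub (h1.const_smul (c k)))
  exact (((h4.add h2).sub (h5.add h3)).div_const _).smul (measurable_cwInv.comp h1)

lemma measurable (hrun : IsRun P f a c x ξ ξhat εp εm) (hf : Continuous f) (k : ℕ) :
    Measurable (x k) := by
  induction k with
  | zero => exact hrun.measurable_init
  | succ k ih =>
    have hg := hrun.measurable_gHat_of hf ih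
    have hd := (measurable_damping.comp hg).const_mul (a k)
    rw [show x (k + 1) = fun ω => _ from funext (hrun.step k)]
    exact (ih.sub (hd.smul hg)).sub (hd.smul (hrun.measurable_dir k))

lemma measurable_gHat (hrun : IsRun P f a c x ξ ξhat εp εm) (hf : Continuous f) (k : ℕ) :
    Measurable (gHat f c x ξ εp εm k) := hrun.measurable_gHat_of hf (hrun.measurable hf k)

lemma history_le (hrun : IsRun P f a c x ξ ξhat εp εm) (hf : Continuous f) (k : ℕ) :
    history x k ≤ ‹MeasurableSpace Ω› :=
  iSup₂_le fun i _ => (hrun.measurable hf i).comap_le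

lemma pert_mem_signCube (hrun : IsRun P f a c x ξ ξhat εp εm) (k : ℕ) :
    ∀ᵐ ω ∂P, ξ k ω ∈ signCube n := by
  have h1 : (P.map (ξ k)) (signCube n)ᶜ = 0 := by
    rw [hrun.pert_law k, uniformOn_eq_zero_iff (finite_signCube n), Set.inter_compl_self]
  rw [Measure.map_apply (hrun.measurable_pert k) (finite_signCube n).measurableSet.compl] at h1
  exact h1

/-- The law of the direction is given only conditionally; integrating the conditional probability of
the whole cube, which is `1`, yields the unconditional statement. -/
lemma dir_mem_signCube [IsProbabilityMeasure P] (hrun : IsRun P f a c x ξ ξhat εp εm) (hf : Continuous f) (k : ℕ) :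
    ∀ᵐ ω ∂P, ξhat k ω ∈ signCube n := by
  have hG : history x k ⊔ MeasurableSpace.comap (gHat f c x ξ εp εm k) inferInstance
      ≤ ‹MeasurableSpace Ω› :=
    sup_le (hrun.history_le hf k) (hrun.measurable_gHat hf k).comap_le
  have hB : MeasurableSet (ξhat k ⁻¹' signCube n) :=
    hrun.measurable_dir k (finite_signCube n).measurableSet
  have h1 := integral_congr_ae (hrun.dir_law k (signCube n) (finite_signCube n).measurableSet)
  rw [integral_condExp hG, integral_indicator hB] at h1
  simp only [uniformOn_halfCube_signCube, integral_const, probReal_univ,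
    smul_eq_mul, mul_one] at h1
  simp only [measureReal_restrict_apply_univ] at h1
  exact (mem_ae_iff_prob_eq_one hB).2 ((ENNReal.toReal_eq_one_iff _).1 h1)

lemma pert_prob (hrun : IsRun P f a c x ξ ξhat εp εm) (k : ℕ) (A : Finset (Fin n)) :
    P.real (ξ k ⁻¹' {signVec A}) = ((2 : ℝ) ^ n)⁻¹ := by
  rw [← uniformOn_signCube_real A, ← hrun.pert_law k, map_measureReal_apply (hrun.measurable_pert k)
    (measurableSet_singleton _)]

end IsRun

omit [MeasurableSpace Ω] in
/-- A random sign vector, read off from the indicators of its possible values. -/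
lemma eq_sum_indicator {η : Ω → E n} {ω : Ω} (h : η ω ∈ signCube n) (ψ : E n → ℝ) :
    ψ (η ω) = ∑ A : Finset (Fin n),
      ψ (signVec A) * (η ⁻¹' {signVec A}).indicator (fun _ => (1 : ℝ)) ω := by
  obtain ⟨B, hB⟩ := (signCube_eq_range n).subset h
  rw [Finset.sum_eq_single B]
  · rw [Set.indicator_of_mem (by simp [hB]), mul_one, hB]
  · intro A _ hAB
    rw [Set.indicator_of_notMem, mul_zero]
    intro hcon
    exact hAB (signVec_injective (Eq.trans (Eq.symm hcon) hB.symm))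
  · simp

end Run

/-! ### Conditional means of the gradient estimate and of the step -/

section Run

variable {Ω : Type*} [MeasurableSpace Ω] {n : ℕ} {P : Measure Ω}
  {f : E n → ℝ} {a c : ℕ → ℝ} {x ξ ξhat : ℕ → Ω → E n} {εp εm : ℕ → Ω → ℝ}

omit [MeasurableSpace Ω] in
/-- Noise free part and noise part of the gradient estimate, in coordinate `i`. -/
lemma gHat_apply (k : ℕ) (i : Fin n) (ω : Ω) :
    gHat f c x ξ εp εm k ω i = diffQuot f (c k) (x k ω) (ξ k ω) * (ξ k ω i)⁻¹
      + (2 * c k)⁻¹ * (ξ k ω i)⁻¹ * (εp k ω - εm k ω) := by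
  change ((f (x k ω + c k • ξ k ω) + εp k ω) - (f (x k ω - c k • ξ k ω) + εm k ω)) / (2 * c k)
    * (ξ k ω i)⁻¹ = _
  rw [diffQuot]
  ring

lemma step_apply (hrun : IsRun P f a c x ξ ξhat εp εm) (k : ℕ) (i : Fin n) (ω : Ω) :
    x (k + 1) ω i - x k ω i = -(a k * damping (gHat f c x ξ εp εm k ω))
      * (gHat f c x ξ εp εm k ω i + ξhat k ω i) := by
  rw [hrun.step k ω, fullStep, halfStep]
  simp only [PiLp.sub_apply, PiLp.smul_apply, smul_eq_mul]
  ring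

lemma abs_eq_one_of_mem_signCube {v : E n} (hv : v ∈ signCube n) (i : Fin n) : |v i| = 1 := by
  rcases hv i with h | h <;> simp [h]

lemma measurable_diffQuot (hf : Continuous f) (c : ℝ) : Measurable fun p : E n × E n =>
    diffQuot f c p.1 p.2 := by
  unfold diffQuot
  fun_prop

/-- Square integrability of the data entering iteration `k`. -/
structure HasSecondMoments (P : Measure Ω) (f : E n → ℝ) (c : ℕ → ℝ) (x ξ : ℕ → Ω → E n)
    (εp εm : ℕ → Ω → ℝ) (k : ℕ) : Prop where
  noise_plus : Integrable (fun ω => εp k ω ^ 2) P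
  noise_minus : Integrable (fun ω => εm k ω ^ 2) P
  value_plus : Integrable (fun ω => f (x k ω + c k • ξ k ω) ^ 2) P
  value_minus : Integrable (fun ω => f (x k ω - c k • ξ k ω) ^ 2) P

/-- The σ-algebra generated by `x_0, …, x_k` and `g`. -/
abbrev historyWith (x : ℕ → Ω → E n) (g : Ω → E n) (k : ℕ) : MeasurableSpace Ω :=
  history x k ⊔ MeasurableSpace.comap g inferInstance

namespace IsRun

lemma memLp_noise (hrun : IsRun P f a c x ξ ξhat εp εm) {k : ℕ}
    (h : HasSecondMoments P f c x ξ εp εm k) : MemLp (fun ω => εp k ω - εm k ω) 2 P :=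
  ((memLp_two_iff_integrable_sq (hrun.measurable_noise_plus k).aestronglyMeasurable).2
    h.noise_plus).sub
  ((memLp_two_iff_integrable_sq (hrun.measurable_noise_minus k).aestronglyMeasurable).2
    h.noise_minus)

lemma memLp_diffQuot (hrun : IsRun P f a c x ξ ξhat εp εm) (hf : Continuous f) {k : ℕ}
    (h : HasSecondMoments P f c x ξ εp εm k) :
    MemLp (fun ω => diffQuot f (c k) (x k ω) (ξ k ω)) 2 P := by
  have hx := hrun.measurable hf k
  have hξ := hrun.measurable_pert k
  have h1 : Measurable fun ω => f (x k ω + c k • ξ k ω) :=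
    hf.measurable.comp (hx.add (hξ.const_smul (c k)))
  have h2 : Measurable fun ω => f (x k ω - c k • ξ k ω) :=
    hf.measurable.comp (hx.sub (hξ.const_smul (c k)))
  have h3 := (((memLp_two_iff_integrable_sq h1.aestronglyMeasurable).2 h.value_plus).sub
    ((memLp_two_iff_integrable_sq h2.aestronglyMeasurable).2 h.value_minus)).const_mul (2 * c k)⁻¹
  convert h3 using 2 with ω
  simp only [diffQuot, Pi.sub_apply]
  ring

lemma memLp_gHat [IsProbabilityMeasure P] (hrun : IsRun P f a c x ξ ξhat εp εm) (hf : Continuous f) {k : ℕ}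
    (h : HasSecondMoments P f c x ξ εp εm k) (i : Fin n) :
    MemLp (fun ω => gHat f c x ξ εp εm k ω i) 2 P := by
  have h1 := (hrun.memLp_diffQuot hf h).add ((hrun.memLp_noise h).const_mul (2 * c k)⁻¹)
  refine h1.of_le ((measurable_coord i).comp (hrun.measurable_gHat hf k)).aestronglyMeasurable ?_
  filter_upwards [hrun.pert_mem_signCube k] with ω hω
  rw [gHat_apply, show diffQuot f (c k) (x k ω) (ξ k ω) * (ξ k ω i)⁻¹
      + (2 * c k)⁻¹ * (ξ k ω i)⁻¹ * (εp k ω - εm k ω) = (diffQuot f (c k) (x k ω) (ξ k ω)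
      + (2 * c k)⁻¹ * (εp k ω - εm k ω)) * (ξ k ω i)⁻¹ by ring, norm_mul, norm_inv,
    Real.norm_eq_abs (ξ k ω i), abs_eq_one_of_mem_signCube hω, inv_one, mul_one]
  rfl

lemma memLp_step [IsProbabilityMeasure P] (hrun : IsRun P f a c x ξ ξhat εp εm) (hf : Continuous f) {k : ℕ}
    (h : HasSecondMoments P f c x ξ εp εm k) (i : Fin n) :
    MemLp (fun ω => x (k + 1) ω i - x k ω i) 2 P := by
  have h1 := ((hrun.memLp_gHat hf h i).norm.add (memLp_const (1 : ℝ))).const_mul |a k|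
  refine h1.of_le (((measurable_coord i).comp (hrun.measurable hf (k + 1))).sub
    ((measurable_coord i).comp (hrun.measurable hf k))).aestronglyMeasurable ?_
  filter_upwards [hrun.dir_mem_signCube hf k] with ω hω
  rw [step_apply hrun]
  simp only [Pi.add_apply, Real.norm_eq_abs, abs_mul, abs_neg, abs_abs]
  rw [abs_of_nonneg (damping_nonneg _), mul_assoc]
  refine mul_le_mul_of_nonneg_left ?_ (abs_nonneg _)
  have h2 := abs_add_le (gHat f c x ξ εp εm k ω i) (ξhat k ω i)
  rw [abs_eq_one_of_mem_signCube hω] at h2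
  rw [abs_of_nonneg (add_nonneg (abs_nonneg (gHat f c x ξ εp εm k ω i)) zero_le_one)]
  calc _ ≤ 1 * |gHat f c x ξ εp εm k ω i + ξhat k ω i| :=
        mul_le_mul_of_nonneg_right (damping_le_one _) (abs_nonneg _)
    _ ≤ _ := by rw [one_mul]; exact h2

/-- Given the history and the perturbation `ξ_k`, the noise has mean zero, and given the history
alone the perturbation is uniform: the gradient estimate has conditional mean
`meanGradEst f c x_k`. -/
lemma condExp_gHat [IsProbabilityMeasure P] (hrun : IsRun P f a c x ξ ξhat εp εm) (hf : Continuous f) {k : ℕ}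
    (h : HasSecondMoments P f c x ξ εp εm k)
    (hnoise : P[fun ω => εp k ω - εm k ω |
      history x k ⊔ MeasurableSpace.comap (ξ k) inferInstance] =ᵐ[P] 0) (i : Fin n) :
    P[fun ω => gHat f c x ξ εp εm k ω i | history x k]
      =ᵐ[P] fun ω => meanGradEst f (c k) (x k ω) i := by
  have hF := hrun.history_le hf k
  have hξ := hrun.measurable_pert k
  have hFH : history x k ≤ history x k ⊔ MeasurableSpace.comap (ξ k) inferInstance := le_sup_left
  have hH : history x k ⊔ MeasurableSpace.comap (ξ k) inferInstance ≤ ‹MeasurableSpace Ω› :=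
    sup_le hF hξ.comap_le
  set T : Ω → ℝ := fun ω => (2 * c k)⁻¹ * (ξ k ω i)⁻¹ with hT
  set N : Ω → ℝ := fun ω => εp k ω - εm k ω with hN
  set ψ : Finset (Fin n) → Ω → ℝ := fun A ω =>
    diffQuot f (c k) (x k ω) (signVec A) * signVec A i with hψ
  set I : Finset (Fin n) → Ω → ℝ := fun A => (ξ k ⁻¹' {signVec A}).indicator fun _ => 1 with hI
  have hA : ∀ A, MeasurableSet (ξ k ⁻¹' {signVec A}) := fun A => hξ (measurableSet_singleton _)
  have hIint : ∀ A, Integrable (I A) P := fun A => (integrable_const 1).indicator (hA A)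
  have hNint : Integrable N P := (hrun.memLp_noise h).integrable one_le_two
  -- the noise part
  have hTmeas : StronglyMeasurable[history x k ⊔ MeasurableSpace.comap (ξ k) inferInstance] T := by
    have h1 : Measurable[MeasurableSpace.comap (ξ k) inferInstance] (ξ k) := comap_measurable _
    have h2 : Measurable fun v : E n => (2 * c k)⁻¹ * (v i)⁻¹ :=
      (measurable_coord i).inv.const_mul _
    have h3 : Measurable[history x k ⊔ MeasurableSpace.comap (ξ k) inferInstance] T :=
      (h2.comp h1).mono le_sup_right le_rfl
    exact h3.stronglyMeasurable
  have hTN : Integrable (T * N) P := by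
    refine Integrable.bdd_mul (c := |(2 * c k)⁻¹|) hNint
      (hTmeas.mono hH).aestronglyMeasurable ?_
    filter_upwards [hrun.pert_mem_signCube k] with ω hω
    rw [hT, norm_mul, norm_inv (ξ k ω i), Real.norm_eq_abs, Real.norm_eq_abs,
      abs_eq_one_of_mem_signCube hω, inv_one, mul_one]
  have hnoise' : P[T * N | history x k] =ᵐ[P] 0 := by
    have h1 : P[T * N | history x k ⊔ MeasurableSpace.comap (ξ k) inferInstance] =ᵐ[P] 0 := by
      filter_upwards [condExp_mul_of_stronglyMeasurable_left hTmeas hTN hNint, hnoise] with ω h1 h2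
      rw [h1, Pi.mul_apply, h2, Pi.zero_apply, mul_zero]
    refine (condExp_condExp_of_le hFH hH).symm.trans ((condExp_congr_ae h1).trans ?_)
    rw [condExp_zero]
  -- the noise free part
  have hψmeas : ∀ A, StronglyMeasurable[history x k] (ψ A) := fun A => by
    have h1 : Measurable[history x k] (x k) :=
      (comap_measurable (x k)).mono (le_iSup₂_of_le k le_rfl le_rfl) le_rfl
    have h2 : Measurable fun v : E n => diffQuot f (c k) v (signVec A) * signVec A i :=
      ((measurable_diffQuot hf (c k)).comp (measurable_id.prodMk measurable_const)).mul_const _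
    exact (h2.comp h1).stronglyMeasurable
  -- The moment assumptions concern `f` at `x_k ± c_k ξ_k` only. On the event `ξ_k = signVec A` the
  -- fixed direction is the random one, which gives the domination.
  have hψI : ∀ A, Integrable (ψ A * I A) P := fun A => by
    refine ((hrun.memLp_diffQuot hf h).integrable one_le_two).mono
      (((hψmeas A).mono hF).aestronglyMeasurable.mul (hIint A).aestronglyMeasurable)
      (Eventually.of_forall fun ω => ?_)
    by_cases hω : ξ k ω = signVec A
    · have h1 : I A ω = 1 := Set.indicator_of_mem (by exact hω) _
      rw [Pi.mul_apply, h1, mul_one, hψ, norm_mul, Real.norm_eq_abs (signVec A i),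
        abs_eq_one_of_mem_signCube (signVec_mem_signCube A), mul_one, hω]
    · have h1 : I A ω = 0 := Set.indicator_of_notMem (by exact hω) _
      rw [Pi.mul_apply, h1, mul_zero, norm_zero]
      positivity
  have hcondI : ∀ A, P[I A | history x k] =ᵐ[P] fun _ => ((2 : ℝ) ^ n)⁻¹ := fun A => by
    have h1 : StronglyMeasurable[MeasurableSpace.comap (ξ k) inferInstance] (I A) :=
      stronglyMeasurable_const.indicator ⟨_, measurableSet_singleton (signVec A), rfl⟩
    have h2 := condExp_indep_eq hξ.comap_le hF h1 (hrun.pert_indep k)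
    rwa [integral_indicator_const (1 : ℝ) (hA A), hrun.pert_prob, smul_eq_mul, mul_one] at h2
  have hsum : P[∑ A, ψ A * I A | history x k] =ᵐ[P] fun ω => meanGradEst f (c k) (x k ω) i := by
    refine (condExp_finsetSum (fun A _ => hψI A) _).trans ?_
    have h1 : ∀ᵐ ω ∂P, ∀ A, (P[ψ A * I A | history x k]) ω = ψ A ω * ((2 : ℝ) ^ n)⁻¹ := by
      rw [ae_all_iff]
      intro A
      filter_upwards [condExp_mul_of_stronglyMeasurable_left (hψmeas A) (hψI A) (hIint A),
        hcondI A] with ω h1 h2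
      rw [h1, Pi.mul_apply, h2]
    filter_upwards [h1] with ω hω
    have h2 : meanGradEst f (c k) (x k ω) i = ((2 : ℝ) ^ n)⁻¹ * ∑ A, ψ A ω := by
      simp [meanGradEst, hψ]
    rw [Finset.sum_apply, Finset.sum_congr rfl fun A _ => hω A, h2, ← Finset.sum_mul, mul_comm]
  have hdecomp : (fun ω => gHat f c x ξ εp εm k ω i) =ᵐ[P] (∑ A, ψ A * I A) + T * N := by
    filter_upwards [hrun.pert_mem_signCube k] with ω hω
    have h1 := eq_sum_indicator (η := ξ k) hω fun v => diffQuot f (c k) (x k ω) v * v i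
    have h2 : (ξ k ω i)⁻¹ = ξ k ω i := by
      rcases hω i with h | h <;> simp [h]
    rw [gHat_apply, Pi.add_apply, Finset.sum_apply]
    simp only [Pi.mul_apply, hT, hN, hψ, hI]
    rw [← h1, h2]
  refine (condExp_congr_ae hdecomp).trans ((condExp_add (integrable_finsetSum' _ fun A _ => hψI A)
    hTN _).trans ?_)
  filter_upwards [hsum, hnoise'] with ω h1 h2
  rw [Pi.add_apply, h1, h2, Pi.zero_apply, add_zero]

/-- Given the history and the gradient estimate, the conditional mean of the step is `-a_k ĝ_k`. -/
lemma condExp_step_gHat [IsProbabilityMeasure P] (hrun : IsRun P f a c x ξ ξhat εp εm) (hf : Continuous f) {k : ℕ}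
    (h : HasSecondMoments P f c x ξ εp εm k) (i : Fin n) :
    P[fun ω => x (k + 1) ω i - x k ω i |
      historyWith x (gHat f c x ξ εp εm k) k]
      =ᵐ[P] fun ω => -a k * gHat f c x ξ εp εm k ω i := by
  set g := gHat f c x ξ εp εm k with hg
  have hG : historyWith x g k ≤ ‹MeasurableSpace Ω› :=
    sup_le (hrun.history_le hf k) (hrun.measurable_gHat hf k).comap_le
  have hgG : Measurable[historyWith x g k] g := (comap_measurable g).mono le_sup_right le_rfl
  set w : Ω → ℝ := fun ω => -(a k * damping (g ω)) with hw
  have hwG : StronglyMeasurable[historyWith x g k] w :=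
    (((measurable_damping.comp hgG).const_mul (a k)).neg).stronglyMeasurable
  have hwbdd : ∀ ω, ‖w ω‖ ≤ |a k| := fun ω => by
    rw [hw, norm_neg, norm_mul, Real.norm_eq_abs, Real.norm_of_nonneg (damping_nonneg _)]
    exact mul_le_of_le_one_right (abs_nonneg _) (damping_le_one _)
  set I : Finset (Fin n) → Ω → ℝ := fun A => (ξhat k ⁻¹' {signVec A}).indicator fun _ => 1 with hI
  have hIint : ∀ A, Integrable (I A) P := fun A =>
    (integrable_const 1).indicator (hrun.measurable_dir k (measurableSet_singleton _))
  have hgi : Integrable (fun ω => g ω i) P := (hrun.memLp_gHat hf h i).integrable one_le_two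
  have hgiG : StronglyMeasurable[historyWith x g k] fun ω => g ω i :=
    ((measurable_coord i).comp hgG).stronglyMeasurable
  have h1int : Integrable (w * fun ω => g ω i) P :=
    hgi.bdd_mul (c := |a k|) (hwG.mono hG).aestronglyMeasurable (Eventually.of_forall hwbdd)
  set u : Finset (Fin n) → Ω → ℝ := fun A ω => w ω * signVec A i with hu
  have huG : ∀ A, StronglyMeasurable[historyWith x g k] (u A) := fun A => hwG.mul stronglyMeasurable_const
  have huI : ∀ A, Integrable (u A * I A) P := fun A => by
    refine (hIint A).bdd_mul (c := |a k|) ((huG A).mono hG).aestronglyMeasurable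
      (Eventually.of_forall fun ω => ?_)
    rw [hu, norm_mul, Real.norm_eq_abs (signVec A i),
      abs_eq_one_of_mem_signCube (signVec_mem_signCube A), mul_one]
    exact hwbdd ω
  have hdecomp : (fun ω => x (k + 1) ω i - x k ω i)
      =ᵐ[P] (w * fun ω => g ω i) + ∑ A, u A * I A := by
    filter_upwards [hrun.dir_mem_signCube hf k] with ω hω
    have h1 := eq_sum_indicator (η := ξhat k) hω fun v => w ω * v i
    rw [step_apply hrun, Pi.add_apply, Finset.sum_apply]
    simp only [Pi.mul_apply, hu, hI]
    rw [← h1]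
    simp only [hw, hg]
    ring
  have hcond : ∀ᵐ ω ∂P, ∀ A, (P[u A * I A | historyWith x g k]) ω
      = u A ω * (uniformOn (halfCube (g ω))).real {signVec A} := by
    rw [ae_all_iff]
    intro A
    filter_upwards [condExp_mul_of_stronglyMeasurable_left (huG A) (huI A) (hIint A),
      hrun.dir_law k {signVec A} (measurableSet_singleton _)] with ω h1 h2
    rw [h1, Pi.mul_apply]
    exact congrArg _ h2
  refine (condExp_congr_ae hdecomp).trans ((condExp_add h1int
    (integrable_finsetSum' _ fun A _ => huI A) _).trans ?_)
  rw [condExp_of_stronglyMeasurable hG (hwG.mul hgiG) h1int]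
  filter_upwards [condExp_finsetSum (fun A (_ : A ∈ Finset.univ) => huI A) (historyWith x g k), hcond,
    hrun.pert_mem_signCube k] with ω h1 h2 h3
  -- The estimate is by definition a multiple of `cwInv (ξ k ω)`, so the cancellation between
  -- damping and mean direction applies.
  obtain ⟨σ, hσ⟩ : ∃ σ : ℝ, g ω = σ • cwInv (ξ k ω) := ⟨_, rfl⟩
  have h4 := damping_mul_add_mean (cwInv_mem_signCube h3) σ i
  rw [← hσ] at h4
  rw [Pi.add_apply, h1, Finset.sum_apply, Finset.sum_congr rfl fun A _ => h2 A, Pi.mul_apply]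
  simp only [hu, mul_assoc, ← Finset.mul_sum, hw]
  linear_combination (-a k) * h4

lemma condExp_step [IsProbabilityMeasure P] (hrun : IsRun P f a c x ξ ξhat εp εm) (hf : Continuous f) {k : ℕ}
    (h : HasSecondMoments P f c x ξ εp εm k)
    (hnoise : P[fun ω => εp k ω - εm k ω |
      history x k ⊔ MeasurableSpace.comap (ξ k) inferInstance] =ᵐ[P] 0) (i : Fin n) :
    P[fun ω => x (k + 1) ω i - x k ω i | history x k]
      =ᵐ[P] fun ω => -a k * meanGradEst f (c k) (x k ω) i := by
  have hG : historyWith x (gHat f c x ξ εp εm k) k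
      ≤ ‹MeasurableSpace Ω› :=
    sup_le (hrun.history_le hf k) (hrun.measurable_gHat hf k).comap_le
  refine (condExp_condExp_of_le le_sup_left hG).symm.trans
    ((condExp_congr_ae (hrun.condExp_step_gHat hf h i)).trans ?_)
  filter_upwards [condExp_smul (-a k) (fun ω => gHat f c x ξ εp εm k ω i) (history x k) (μ := P),
    hrun.condExp_gHat hf h hnoise i] with ω h1 h2
  refine h1.trans ?_
  rw [Pi.smul_apply, h2, smul_eq_mul]

end IsRun
end Run

/-! ### Second moments of the steps and convergence of the accumulated error -/

section Run

variable {Ω : Type*} [MeasurableSpace Ω] {n : ℕ} {P : Measure Ω}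
  {f : E n → ℝ} {a c : ℕ → ℝ} {x ξ ξhat : ℕ → Ω → E n} {εp εm : ℕ → Ω → ℝ}

/-- The square of the four-term difference is at most `4` times the sum of squares, which cancels
the `4` in `(2 c_k)²`. Adding the direction costs a factor `2`, and the four moments sum to at most
`2 (α₀ + α₁)`. -/
lemma IsRun.integral_step_sq_le [IsProbabilityMeasure P] (hrun : IsRun P f a c x ξ ξhat εp εm)
    (hf : Continuous f) {k : ℕ} (h : HasSecondMoments P f c x ξ εp εm k) {α₀ α₁ : ℝ}
    (h1 : ∫ ω, εp k ω ^ 2 ∂P ≤ α₀) (h2 : ∫ ω, εm k ω ^ 2 ∂P ≤ α₀)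
    (h3 : ∫ ω, f (x k ω + c k • ξ k ω) ^ 2 ∂P ≤ α₁)
    (h4 : ∫ ω, f (x k ω - c k • ξ k ω) ^ 2 ∂P ≤ α₁) (i : Fin n) :
    ∫ ω, (x (k + 1) ω i - x k ω i) ^ 2 ∂P ≤ 4 * (α₀ + α₁) * (a k / c k) ^ 2 + 2 * a k ^ 2 := by
  have hp := h.value_plus.add h.noise_plus
  have hm := h.value_minus.add h.noise_minus
  have hint := ((hp.add hm).const_mul (2 * (a k / c k) ^ 2)).add (integrable_const (2 * a k ^ 2))
  refine (integral_mono_ae (hrun.memLp_step hf h i).integrable_sq hint ?_).trans ?_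
  · filter_upwards [hrun.pert_mem_signCube k, hrun.dir_mem_signCube hf k] with ω hξ hd
    rw [step_apply hrun]
    simp only [Pi.add_apply]
    have hg : gHat f c x ξ εp εm k ω i ^ 2 = ((f (x k ω + c k • ξ k ω) + εp k ω)
        - (f (x k ω - c k • ξ k ω) + εm k ω)) ^ 2 * ((c k)⁻¹ ^ 2 / 4) := by
      have h5 : ((ξ k ω i)⁻¹) ^ 2 = 1 := by rcases hξ i with h | h <;> simp [h]
      change (((f (x k ω + c k • ξ k ω) + εp k ω) - (f (x k ω - c k • ξ k ω) + εm k ω)) / (2 * c k)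
        * (ξ k ω i)⁻¹) ^ 2 = _
      rw [mul_pow, h5, mul_one, div_eq_mul_inv, mul_pow, mul_inv]
      ring
    have hd2 : ξhat k ω i ^ 2 = 1 := by rcases hd i with h | h <;> simp [h]
    have hdamp : damping (gHat f c x ξ εp εm k ω) ^ 2 ≤ 1 :=
      pow_le_one₀ (damping_nonneg _) (damping_le_one _)
    have hsq : ((f (x k ω + c k • ξ k ω) + εp k ω) - (f (x k ω - c k • ξ k ω) + εm k ω)) ^ 2
        ≤ 4 * (f (x k ω + c k • ξ k ω) ^ 2 + εp k ω ^ 2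
          + (f (x k ω - c k • ξ k ω) ^ 2 + εm k ω ^ 2)) := by
      generalize f (x k ω + c k • ξ k ω) = p, f (x k ω - c k • ξ k ω) = q, εp k ω = s, εm k ω = t
      nlinarith [sq_nonneg (p - s), sq_nonneg (p + q), sq_nonneg (p + t), sq_nonneg (s + q),
        sq_nonneg (s + t), sq_nonneg (q - t)]
    have hsum : (gHat f c x ξ εp εm k ω i + ξhat k ω i) ^ 2
        ≤ 2 * (gHat f c x ξ εp εm k ω i ^ 2 + 1) := by
      rw [← hd2]; nlinarith [sq_nonneg (gHat f c x ξ εp εm k ω i - ξhat k ω i)]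
    calc _ = damping (gHat f c x ξ εp εm k ω) ^ 2
          * (a k ^ 2 * (gHat f c x ξ εp εm k ω i + ξhat k ω i) ^ 2) := by ring
      _ ≤ 1 * (a k ^ 2 * (2 * (gHat f c x ξ εp εm k ω i ^ 2 + 1))) := by gcongr
      _ ≤ 1 * (a k ^ 2 * (2 * (4 * (f (x k ω + c k • ξ k ω) ^ 2 + εp k ω ^ 2
          + (f (x k ω - c k • ξ k ω) ^ 2 + εm k ω ^ 2)) * ((c k)⁻¹ ^ 2 / 4) + 1))) := by
        rw [hg]; gcongr
      _ = _ := by rw [div_eq_mul_inv (a k), mul_pow]; ring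
  · have e1 := integral_add hp hm
    have e2 := integral_add h.value_plus h.noise_plus
    have e3 := integral_add h.value_minus h.noise_minus
    have e4 := integral_add ((hp.add hm).const_mul (2 * (a k / c k) ^ 2))
      (integrable_const (2 * a k ^ 2))
    simp only [Pi.add_apply] at e1 e2 e3 e4 ⊢
    rw [e4, integral_const_mul, e1, e2, e3]
    simp only [integral_const, probReal_univ, smul_eq_mul, one_mul]
    have h5 : 0 ≤ (a k / c k) ^ 2 := sq_nonneg _
    nlinarith

/-- The filtration generated by the iterates. -/
def IsRun.filtration (hrun : IsRun P f a c x ξ ξhat εp εm) (hf : Continuous f) :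
    Filtration ℕ ‹MeasurableSpace Ω› where
  seq := history x
  mono' _ _ hkl := biSup_mono fun _ hi => hi.trans hkl
  le' := hrun.history_le hf

/-- The accumulated deviations of the steps from their conditional means converge. -/
lemma IsRun.ae_exists_tendsto_error [IsProbabilityMeasure P]
    (hrun : IsRun P f a c x ξ ξhat εp εm) (hf : Continuous f)
    (hnoise : ∀ k, P[fun ω => εp k ω - εm k ω |
      history x k ⊔ MeasurableSpace.comap (ξ k) inferInstance] =ᵐ[P] 0)
    (hc_pos : ∀ k, 0 < c k) (hc_lim : Tendsto c atTop (𝓝 0))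
    (hac_sum : Summable fun k => (a k / c k) ^ 2)
    (hmom : ∀ k, HasSecondMoments P f c x ξ εp εm k) {α₀ α₁ : ℝ}
    (h1 : ∀ k, ∫ ω, εp k ω ^ 2 ∂P ≤ α₀) (h2 : ∀ k, ∫ ω, εm k ω ^ 2 ∂P ≤ α₀)
    (h3 : ∀ k, ∫ ω, f (x k ω + c k • ξ k ω) ^ 2 ∂P ≤ α₁)
    (h4 : ∀ k, ∫ ω, f (x k ω - c k • ξ k ω) ^ 2 ∂P ≤ α₁) :
    ∀ᵐ ω ∂P, ∃ e' : E n, Tendsto (fun N => ∑ k ∈ Finset.range N,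
      (x (k + 1) ω - x k ω + a k • meanGradEst f (c k) (x k ω))) atTop (𝓝 e') := by
  -- A bound `C` for the `c_k` gives `a_k² ≤ C² (a_k / c_k)²`, so the `2 a_k²` in the moment bound
  -- is summable as well.
  obtain ⟨C, hC⟩ : ∃ C, ∀ k, c k ≤ C := by
    obtain ⟨C, hC⟩ := hc_lim.bddAbove_range
    exact ⟨C, fun k => hC ⟨k, rfl⟩⟩
  have hcoord : ∀ i : Fin n, ∀ᵐ ω ∂P, ∃ l, Tendsto (fun N => ∑ k ∈ Finset.range N,
      (x (k + 1) ω - x k ω + a k • meanGradEst f (c k) (x k ω)) i) atTop (𝓝 l) := by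
    intro i
    have hcond := fun k => hrun.condExp_step hf (hmom k) (hnoise k) i
    have hcentered : ∀ k, (fun ω => (x (k + 1) ω - x k ω + a k • meanGradEst f (c k) (x k ω)) i)
        =ᵐ[P] (fun ω => x (k + 1) ω i - x k ω i)
          - P[fun ω => x (k + 1) ω i - x k ω i | history x k] := fun k => by
      filter_upwards [hcond k] with ω hω
      rw [Pi.sub_apply, hω]
      simp only [PiLp.add_apply, PiLp.sub_apply, PiLp.smul_apply, smul_eq_mul]
      ring
    have hstep := fun k => hrun.memLp_step hf (hmom k) i
    have hmean : ∀ k, Measurable (meanGradEst f (c k)) := fun k => by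
      have h5 : ∀ A : Finset (Fin n), Measurable fun v : E n => diffQuot f (c k) v (signVec A) :=
        fun A => (measurable_diffQuot hf (c k)).comp (measurable_id.prodMk measurable_const)
      unfold meanGradEst
      fun_prop
    refine ae_exists_tendsto_sum_of_condExp_eq_zero (hrun.filtration hf) (fun k => ?_) (fun k => ?_)
      (fun k => ?_) (hac_sum.mul_left (4 * (α₀ + α₁) + 2 * C ^ 2)) (fun k => ?_)
    · have hx : ∀ j, j ≤ k + 1 → Measurable[history x (k + 1)] (x j) := fun j hj =>
        (comap_measurable (x j)).mono (le_iSup₂_of_le j hj le_rfl) le_rfl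
      have hm := ((hx (k + 1) le_rfl).sub (hx k k.le_succ)).add
        (((hmean k).comp (hx k k.le_succ)).const_smul (a k))
      exact ((measurable_coord i).comp hm).stronglyMeasurable
    · exact ((hstep k).sub (MemLp.condExp one_le_two (hstep k))).ae_eq (hcentered k).symm
    · have hint := (hstep k).integrable one_le_two
      refine (condExp_congr_ae (hcentered k)).trans
        ((condExp_sub hint integrable_condExp _).trans ?_)
      have := condExp_of_stronglyMeasurable (hrun.history_le hf k)
        (stronglyMeasurable_condExp (f := fun ω => x (k + 1) ω i - x k ω i) (μ := P))
        integrable_condExp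
      change P[fun ω => x (k + 1) ω i - x k ω i | history x k]
        - P[P[fun ω => x (k + 1) ω i - x k ω i | history x k] | history x k] =ᵐ[P] 0
      rw [this, sub_self]
    · have hle := integral_sub_condExp_sq_le (hrun.history_le hf k) (hstep k)
      have heq : ∫ ω, ((x (k + 1) ω - x k ω + a k • meanGradEst f (c k) (x k ω)) i) ^ 2 ∂P
          = ∫ ω, ((x (k + 1) ω i - x k ω i)
            - (P[fun ω => x (k + 1) ω i - x k ω i | history x k]) ω) ^ 2 ∂P :=
        integral_congr_ae ((hcentered k).mono fun ω hω => congrArg (· ^ 2) hω)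
      have hsq := hrun.integral_step_sq_le hf (hmom k) (h1 k) (h2 k) (h3 k) (h4 k) i
      have ha : a k ^ 2 ≤ C ^ 2 * (a k / c k) ^ 2 := by
        have hne := (hc_pos k).ne'
        have : a k ^ 2 = c k ^ 2 * (a k / c k) ^ 2 := by field_simp
        rw [this]
        have := pow_le_pow_left₀ (hc_pos k).le (hC k) 2
        gcongr
      rw [heq]
      linarith
  filter_upwards [ae_all_iff.2 hcoord] with ω hω
  choose l hl using hω
  refine ⟨WithLp.toLp 2 l, ?_⟩
  have h5 : Tendsto (fun N i => ∑ k ∈ Finset.range N,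
      (x (k + 1) ω - x k ω + a k • meanGradEst f (c k) (x k ω)) i) atTop (𝓝 l) :=
    tendsto_pi_nhds.2 hl
  refine (((PiLp.continuous_toLp 2 _).tendsto l).comp h5).congr fun N => ?_
  ext i
  simp

end Run

end SPSA

end

/-! ### The convergence theorem -/

theorem proposition1 {Ω : Type*} [MeasurableSpace Ω] (P : Measure Ω) [IsProbabilityMeasure P]
    (n : ℕ) (hn : 1 ≤ n)
    -- the objective function and the candidate limit
    (f : SPSA.E n → ℝ) (hf : Differentiable ℝ f) (xs : SPSA.E n)
    -- gains, iterates, search directions and measurement noises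
    (a c : ℕ → ℝ) (x ξ ξhat : ℕ → Ω → SPSA.E n) (εp εm : ℕ → Ω → ℝ)
    (hrun : SPSA.IsRun P f a c x ξ ξhat εp εm)
    -- the noise difference has conditional mean zero given `x_0, …, x_k` and `ξ_k`
    (hnoise : ∀ k, P[fun ω => εp k ω - εm k ω |
        SPSA.history x k ⊔ MeasurableSpace.comap (ξ k) inferInstance] =ᵐ[P] 0)
    -- smoothness of `f` near the iterates
    (hsmooth : ∃ K : ℕ, ∃ r : ℝ, 0 < r ∧
        ∀ᵐ ω ∂P, ∀ k, K ≤ k → SPSA.ThirdDerivGoodNear f (x k ω) r)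
    -- the gains
    (ha_pos : ∀ k, 0 < a k) (hc_pos : ∀ k, 0 < c k)
    (ha_lim : Tendsto a atTop (𝓝 0)) (hc_lim : Tendsto c atTop (𝓝 0))
    (ha_sum : Tendsto (fun N => ∑ k ∈ Finset.range N, a k) atTop atTop)
    (hac_sum : Summable (fun k => (a k / c k) ^ 2))
    -- second moments
    (hmoment : ∃ α₀ : ℝ, 0 < α₀ ∧ ∃ α₁ : ℝ, 0 < α₁ ∧ ∀ k,
        (Integrable (fun ω => εp k ω ^ 2) P ∧ ∫ ω, εp k ω ^ 2 ∂P ≤ α₀) ∧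
        (Integrable (fun ω => εm k ω ^ 2) P ∧ ∫ ω, εm k ω ^ 2 ∂P ≤ α₀) ∧
        (Integrable (fun ω => f (x k ω + c k • ξ k ω) ^ 2) P ∧
          ∫ ω, f (x k ω + c k • ξ k ω) ^ 2 ∂P ≤ α₁) ∧
        (Integrable (fun ω => f (x k ω - c k • ξ k ω) ^ 2) P ∧
          ∫ ω, f (x k ω - c k • ξ k ω) ^ 2 ∂P ≤ α₁))
    -- almost surely bounded iterates
    (hbdd : ∀ᵐ ω ∂P, ∃ R : ℝ, ∀ k, ‖x k ω‖ ≤ R)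
    -- asymptotic stability
    (hstable : SPSA.IsAsymptoticallyStable f xs)
    -- almost surely, a compact part of the domain of attraction is visited infinitely often
    (hvisit : ∃ S : Set (SPSA.E n), IsCompact S ∧ S ⊆ SPSA.domainOfAttraction f xs ∧
        ∀ᵐ ω ∂P, ∃ᶠ k in atTop, x k ω ∈ S) :
    ∀ᵐ ω ∂P, Tendsto (fun k => x k ω) atTop (𝓝 xs) := by
  have hfc := hf.continuous
  obtain ⟨K, r, hr, hsmooth⟩ := hsmooth
  obtain ⟨α₀, -, α₁, -, hmoment⟩ := hmoment
  obtain ⟨S, hS, hSD, hvisit⟩ := hvisit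
  have herr := hrun.ae_exists_tendsto_error hfc hnoise hc_pos hc_lim hac_sum
    (fun k => ⟨(hmoment k).1.1, (hmoment k).2.1.1, (hmoment k).2.2.1.1, (hmoment k).2.2.2.1⟩)
    (fun k => (hmoment k).1.2) (fun k => (hmoment k).2.1.2) (fun k => (hmoment k).2.2.1.2)
    (fun k => (hmoment k).2.2.2.2)
  filter_upwards [hsmooth, hbdd, hvisit, herr] with ω h1 ⟨R, h2⟩ h3 ⟨e', h4⟩
  exact SPSA.tendsto_of_summable_error hr h1 ha_pos hc_pos ha_lim hc_lim ha_sum h2 hstable hS hSD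
    h3 h4
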